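/- Let $p$ be a prime and let $\mathcal{G}=(S,\mathcal{F},\mathcal{L})$ be a $p$-local compact group: $S$ is a discrete $p$-toral group, $\mathcal{F}$ is a saturated fusion system over $S$, and $\mathcal{L}$ is a centric linking system associated to $\mathcal{F}$ (a transporter system whose objects are all the $\mathcal{F}$-centric subgroups of $S$ and such that $\mathrm{Ker}(\mathrm{Aut}_{\mathcal{L}}(P)\to\mathrm{Aut}_{\mathcal{F}}(P))=\varepsilon(Z(P))$ for every object $P$), with structure functors $\mathcal{T}_{\mathrm{Ob}(\mathcal{L})}(S)\xrightarrow{\varepsilon}\mathcal{L}\xrightarrow{\rho}\mathcal{F}$, where $\mathcal{T}_{\mathrm{Ob}(\mathcal{L})}(S)$ is the transporter category of $S$. For $P\in\mathrm{Ob}(\mathcal{L})$ regard $N_S(P)$ as a subgroup of $\mathrm{Aut}_{\mathcal{L}}(P)$ via $\varepsilon$. A \emph{Robinson setup} for $\mathcal{G}$ consists of a finite set $\mathcal{P}=\{P_0=S,P_1,\dots,P_k\}$ of fully $\mathcal{F}$-normalised, $\mathcal{F}$-centric subgroups of $S$ that contains at least one representative of each $\mathcal{F}$-conjugacy class of $\mathcal{F}$-centric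 $\mathcal{F}$-radical subgroups, and, with $L_P=\mathrm{Aut}_{\mathcal{L}}(P)$ for $P\in\mathcal{P}$, for each $P\in\mathcal{P}$ with $P\neq S$ a group $N_P$ with monomorphisms $L_S\xleftarrow{k_P}N_P\xrightarrow{j_P}L_P$ and $N_S(P)\le N_P$, such that $k_P$ and $j_P$ restrict on $N_S(P)$ to the embeddings of $N_S(P)$ in $L_S$ and in $L_P$ given by $\varepsilon$. The \emph{Robinson amalgam} is the colimit $G$, in the category of groups, of the tree of groups with vertex groups $L_P$ ($P\in\mathcal{P}$) and, for each $S\ne P\in\mathcal{P}$, one edge joining the vertices of $S$ and $P$, with edge group $N_P$ and edge maps $k_P$, $j_P$. Let $\mathcal{O}(\mathcal{F}^c)$ be the category whose objects are the $\mathcal{F}$-centric subgroups of $S$ and whose morphism sets are $\mathrm{Inn}(Q)\backslash\mathrm{Hom}_{\mathcal{F}}(P,Q)$, let $\mathcal{Z}_{\mathcal{F}}\colon\mathcal{O}(\mathcal{F}^c)^{\mathrm{op}}\to\mathrm{Ab}$ be the functor that sends $P$ to $Z(P)$ and the class of $f\colon P\to Q$ to $f^{-1}\colon Z(Q)\to Z(P)$,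 and define the centre of $\mathcal{G}$ by $Z(\mathcal{G})=\varprojlim_{\mathcal{O}(\mathcal{F}^c)}\mathcal{Z}_{\mathcal{F}}$. Then for every Robinson setup for $\mathcal{G}$, with Robinson amalgam $G$, one has $Z(G)=Z(\mathcal{G})$; precisely, the canonical homomorphism $Z(\mathcal{G})\to Z(S)\le S\xrightarrow{\varepsilon}L_S\to G$ is injective and its image is the centre $Z(G)$ of $G$. -/

import Mathlib

open CategoryTheory CategoryTheory.Limits

universe u

/-! ### Discrete `p`-toral groups -/

/-- The group `ℤ/p^∞`, realised as the group of complex roots of unity of `p`-power order. -/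
abbrev PruferGroup (p : ℕ) : Type := CommGroup.primaryComponent ℂˣ p

/-- `P` has a normal discrete `p`-torus of rank `r` and index `m`, where `m` is a power of `p`;
that is, `P` is discrete `p`-toral of order `(r, m)`. -/
def HasToralOrder (p : ℕ) (P : Type*) [Group P] (r m : ℕ) : Prop :=
  ∃ T : Subgroup P, T.Normal ∧ Nonempty (T ≃* (Fin r → PruferGroup p)) ∧
    T.index = m ∧ ∃ a : ℕ, m = p ^ a

/-- Discrete `p`-toral groups. -/
def IsDiscretePToral (p : ℕ) (P : Type*) [Group P] : Prop :=
  ∃ r m : ℕ, HasToralOrder p P r m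

/-- `|P| ≤ |Q|` for discrete `p`-toral groups: lexicographic comparison of the pairs
(rank, index of the maximal torus). -/
def ToralOrderLE (p : ℕ) (P Q : Type*) [Group P] [Group Q] : Prop :=
  ∃ r m s n : ℕ, HasToralOrder p P r m ∧ HasToralOrder p Q s n ∧ (r < s ∨ (r = s ∧ m ≤ n))

/-- `H` is a Sylow `p`-subgroup of the (arbitrary) group `G`: it is discrete `p`-toral, and every
discrete `p`-toral subgroup of `G` is conjugate to a subgroup of `H`. -/
def IsSylowToral (p : ℕ) {G : Type*} [Group G] (H : Subgroup G) : Prop :=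
  IsDiscretePToral p H ∧
    ∀ K : Subgroup G, IsDiscretePToral p K → ∃ g : G, ∀ x ∈ K, g * x * g⁻¹ ∈ H

/-! ### Transporters and conjugation -/

section Conj

variable {S : Type u} [Group S]

/-- `g` lies in the transporter `N_S(P, Q)`, i.e. `g P g⁻¹ ≤ Q`. -/
def Transports (g : S) (P Q : Subgroup S) : Prop := ∀ x ∈ P, g * x * g⁻¹ ∈ Q

/-- The homomorphism `c_g : P → Q`, `x ↦ g x g⁻¹`. -/
def conjHom {P Q : Subgroup S} (g : S) (h : Transports g P Q) : P →* Q :=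
  ((MulAut.conj g).toMonoidHom.comp P.subtype).codRestrict Q (fun x => h x.1 x.2)

theorem Transports.of_le {P Q : Subgroup S} (h : P ≤ Q) : Transports 1 P Q := by
  intro x hx
  simpa using h hx

theorem Transports.mul {P Q R : Subgroup S} {g h : S} (hh : Transports h Q R)
    (hg : Transports g P Q) : Transports (h * g) P R := by
  intro x hx
  have := hh _ (hg x hx)
  simpa [mul_assoc] using this

theorem Transports.of_mem_normalizer {P : Subgroup S} {g : S}
    (hg : g ∈ Subgroup.normalizer (P : Set S)) : Transports g P P :=
  fun x hx => (Subgroup.mem_normalizer_iff.1 hg x).1 hx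

/-- `Aut_S(P)`: the automorphisms of `P` given by conjugation by elements of `N_S(P)`. -/
def autS (P : Subgroup S) : Subgroup (MulAut P) := P.normalizerMonoidHom.range

end Conj

/-- `Inn(P)`. -/
def innAut (P : Type*) [Group P] : Subgroup (MulAut P) := (MulAut.conj : P →* MulAut P).range

instance innAut_normal (P : Type*) [Group P] : (innAut P).Normal where
  conj_mem := by
    rintro _ ⟨x, rfl⟩ g
    refine ⟨g x, ?_⟩
    ext y
    simp

/-! ### Fusion systems -/

/-- A fusion system over `S`: for all subgroups `P, Q` of `S` a set of injective homomorphisms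
`P → Q`, containing those induced by conjugation in `S`, closed under composition, and such that
each morphism is an isomorphism of the system followed by an inclusion. -/
structure FusionSystem (S : Type u) [Group S] where
  Hom : ∀ P Q : Subgroup S, Set (P →* Q)
  conj_mem : ∀ {P Q : Subgroup S} (g : S) (h : Transports g P Q), conjHom g h ∈ Hom P Q
  injective : ∀ {P Q : Subgroup S}, ∀ f ∈ Hom P Q, Function.Injective f
  comp_mem : ∀ {P Q R : Subgroup S}, ∀ f ∈ Hom P Q, ∀ g ∈ Hom Q R, g.comp f ∈ Hom P R
  factor : ∀ {P Q : Subgroup S}, ∀ f ∈ Hom P Q, ∃ (R : Subgroup S) (hR : R ≤ Q) (e : P ≃* R),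
    e.toMonoidHom ∈ Hom P R ∧ e.symm.toMonoidHom ∈ Hom R P ∧
      f = (Subgroup.inclusion hR).comp e.toMonoidHom

namespace FusionSystem

variable {S : Type u} [Group S] (F : FusionSystem S)

theorem id_mem (P : Subgroup S) : MonoidHom.id P ∈ F.Hom P P := by
  have h := F.conj_mem (1 : S) (Transports.of_le (le_refl P))
  have e : conjHom (1 : S) (Transports.of_le (le_refl P)) = MonoidHom.id P := by
    ext x
    simp [conjHom]
  rwa [e] at h

/-- `e` is an isomorphism of the category `F`. -/
def IsIso {P Q : Subgroup S} (e : P ≃* Q) : Prop :=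
  e.toMonoidHom ∈ F.Hom P Q ∧ e.symm.toMonoidHom ∈ F.Hom Q P

/-- `F`-conjugacy of subgroups. -/
def IsConj (P Q : Subgroup S) : Prop := ∃ e : P ≃* Q, F.IsIso e

/-- `Aut_F(P)`. -/
def aut (P : Subgroup S) : Subgroup (MulAut P) where
  carrier := {e | F.IsIso e}
  one_mem' := ⟨F.id_mem P, F.id_mem P⟩
  mul_mem' := fun {_ _} ha hb => ⟨F.comp_mem _ hb.1 _ ha.1, F.comp_mem _ ha.2 _ hb.2⟩
  inv_mem' := fun {_} ha => ⟨ha.2, ha.1⟩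

/-- `Out_F(P) = Aut_F(P) / Inn(P)`. -/
abbrev Out (P : Subgroup S) : Type u := F.aut P ⧸ (innAut P).subgroupOf (F.aut P)

/-- `Out_S(P)`, the image of `Aut_S(P)` in `Out_F(P)`. -/
def outS (P : Subgroup S) : Subgroup (F.Out P) :=
  ((autS P).subgroupOf (F.aut P)).map (QuotientGroup.mk' _)

/-- Fully `F`-centralised subgroups. -/
def FullyCentralised (p : ℕ) (P : Subgroup S) : Prop :=
  ∀ P' : Subgroup S, F.IsConj P P' →
    ToralOrderLE p (Subgroup.centralizer (P' : Set S)) (Subgroup.centralizer (P : Set S))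

/-- Fully `F`-normalised subgroups. -/
def FullyNormalised (p : ℕ) (P : Subgroup S) : Prop :=
  ∀ P' : Subgroup S, F.IsConj P P' →
    ToralOrderLE p (Subgroup.normalizer (P' : Set S)) (Subgroup.normalizer (P : Set S))

/-- For an isomorphism `f : P → P'`, the subgroup
`N_f = {g ∈ N_S(P) | f c_g f⁻¹ ∈ Aut_S(P')}` of `S`. -/
def extender {P P' : Subgroup S} (f : P ≃* P') : Subgroup S :=
  ((autS P').comap ((MulAut.congr f).toMonoidHom.comp P.normalizerMonoidHom)).map
    (Subgroup.normalizer (P : Set S)).subtype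

/-- Saturated fusion systems. In `extension`, a morphism `P → S` with image `P'` is given as
an isomorphism `f : P ≃* P'`. -/
structure IsSaturated (p : ℕ) : Prop where
  sylow : ∀ P : Subgroup S, F.FullyNormalised p P →
    F.FullyCentralised p P ∧ Finite (F.Out P) ∧ IsSylowToral p (F.outS P)
  extension : ∀ (P P' : Subgroup S) (f : P ≃* P'), F.IsIso f → F.FullyCentralised p P' →
    ∃ f' ∈ F.Hom (extender f) ⊤, ∀ (x : S) (hx : x ∈ P) (hx' : x ∈ extender f),
      (f' ⟨x, hx'⟩ : S) = f ⟨x, hx⟩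
  union : ∀ (P : ℕ → Subgroup S), Monotone P →
    ∀ f : (⨆ n, P n : Subgroup S) →* (⊤ : Subgroup S),
      (∀ n, f.comp (Subgroup.inclusion (le_iSup P n)) ∈ F.Hom (P n) ⊤) → f ∈ F.Hom (⨆ n, P n) ⊤

/-- `F`-centric subgroups: `C_S(P') = Z(P')` for all `P'` that are `F`-conjugate to `P`. -/
def IsCentric (P : Subgroup S) : Prop :=
  ∀ P' : Subgroup S, F.IsConj P P' →
    Subgroup.centralizer (P' : Set S) = (Subgroup.center P').map P'.subtype

/-- `F`-radical subgroups: `Out_F(P)` has no nontrivial normal `p`-subgroup. -/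
def IsRadical (p : ℕ) (P : Subgroup S) : Prop :=
  ∀ K : Subgroup (F.Out P), K.Normal → IsPGroup p K → K = ⊥

/-- A fusion controlling family: a finite set of fully `F`-normalised subgroups that contains `S`
and a representative of each `F`-conjugacy class of `F`-centric `F`-radical subgroups. -/
structure IsFusionControlling (p : ℕ) (fam : Set (Subgroup S)) : Prop where
  finite : fam.Finite
  top_mem : ⊤ ∈ fam
  fullyNormalised : ∀ P ∈ fam, F.FullyNormalised p P
  exists_conj : ∀ Q : Subgroup S, F.IsCentric Q → F.IsRadical p Q → ∃ P ∈ fam, F.IsConj Q P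

/-! ### The centric orbit category and the centre functor -/

/-- The objects of the orbit category `O(F^c)`: the `F`-centric subgroups of `S`. -/
structure OrbitCat where
  sub : Subgroup S
  centric : F.IsCentric sub

variable {F}

/-- Two morphisms `P → Q` of `F` agree in `Rep_F(P, Q) = Inn(Q) \ Hom_F(P, Q)`. -/
def repSetoid (P Q : Subgroup S) : Setoid (F.Hom P Q) where
  r f g := ∃ q : Q, ∀ x : P, g.1 x = q * f.1 x * q⁻¹
  iseqv :=
    { refl := fun f => ⟨1, by simp⟩
      symm := by
        rintro f g ⟨q, hq⟩
        refine ⟨q⁻¹, fun x => ?_⟩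
        rw [hq]
        group
      trans := by
        rintro f g h ⟨q, hq⟩ ⟨r, hr⟩
        refine ⟨r * q, fun x => ?_⟩
        rw [hr, hq]
        group }

/-- The orbit category `O(F^c)`, with morphism sets `Rep_F(P, Q)`. -/
instance : Category.{u} (OrbitCat F) where
  Hom P Q := Quotient (repSetoid (F := F) P.sub Q.sub)
  id P := Quotient.mk _ ⟨MonoidHom.id P.sub, F.id_mem P.sub⟩
  comp {P Q R} := Quotient.map₂ (fun f g => ⟨g.1.comp f.1, F.comp_mem _ f.2 _ g.2⟩) (by
    rintro f f' ⟨q, hq⟩ g g' ⟨r, hr⟩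
    refine ⟨r * g.1 q, fun x => ?_⟩
    simp only [MonoidHom.comp_apply, hr, hq, map_mul, map_inv]
    group)
  id_comp := by
    rintro P Q ⟨f⟩
    rfl
  comp_id := by
    rintro P Q ⟨f⟩
    rfl
  assoc := by
    rintro P Q R T ⟨f⟩ ⟨g⟩ ⟨h⟩
    rfl

/-- If `P` is centric and `f : P → Q` is in `F`, then `Z(Q) ≤ f(P)`; more precisely each
`z ∈ Z(Q)` is `f(x)` for some `x ∈ Z(P)`. -/
theorem exists_center_preimage {P Q : Subgroup S} (hP : F.IsCentric P) {f : P →* Q}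
    (hf : f ∈ F.Hom P Q) (z : Subgroup.center Q) : ∃ x : Subgroup.center P, f x = z := by
  obtain ⟨R, hR, e, he, he', rfl⟩ := F.factor f hf
  have hz : ((z : Q) : S) ∈ Subgroup.centralizer (R : Set S) := by
    rw [Subgroup.mem_centralizer_iff]
    intro y hy
    exact congrArg Subtype.val (Subgroup.mem_center_iff.1 z.2 ⟨y, hR hy⟩)
  rw [hP R ⟨e, he, he'⟩] at hz
  obtain ⟨w, hw, hwz⟩ := hz
  refine ⟨⟨e.symm w, ?_⟩, ?_⟩
  · rw [Subgroup.mem_center_iff]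
    intro g
    apply e.injective
    simpa using Subgroup.mem_center_iff.1 hw (e g)
  · apply Subtype.ext
    simpa using hwz

/-- The homomorphism `Z(Q) → Z(P)`, `z ↦ f⁻¹(z)`, induced by a morphism `f : P → Q` of `F`
with `P` centric. -/
noncomputable def centerMap {P Q : Subgroup S} (hP : F.IsCentric P) (f : F.Hom P Q) :
    Subgroup.center Q →* Subgroup.center P :=
  MonoidHom.mk' (fun z => (exists_center_preimage hP f.2 z).choose) (by
    intro a b
    apply Subtype.ext
    apply F.injective f.1 f.2
    rw [(exists_center_preimage hP f.2 (a * b)).choose_spec, Subgroup.coe_mul, Subgroup.coe_mul,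
      map_mul, (exists_center_preimage hP f.2 a).choose_spec,
      (exists_center_preimage hP f.2 b).choose_spec])

theorem apply_centerMap {P Q : Subgroup S} (hP : F.IsCentric P) (f : F.Hom P Q)
    (z : Subgroup.center Q) : f.1 (centerMap hP f z) = z :=
  (exists_center_preimage hP f.2 z).choose_spec

theorem centerMap_eq_of_apply {P Q : Subgroup S} (hP : F.IsCentric P) (f : F.Hom P Q)
    (z : Subgroup.center Q) (x : Subgroup.center P) (h : f.1 x = z) : centerMap hP f z = x := by
  apply Subtype.ext
  apply F.injective f.1 f.2
  rw [apply_centerMap, h]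

theorem centerMap_congr {P Q : Subgroup S} (hP : F.IsCentric P) (f g : F.Hom P Q)
    (h : repSetoid (F := F) P Q f g) : centerMap hP f = centerMap hP g := by
  obtain ⟨q, hq⟩ := h
  ext1 z
  refine centerMap_eq_of_apply hP f z _ ?_
  have h1 := apply_centerMap hP g z
  rw [hq] at h1
  have h2 : f.1 (centerMap hP g z) = q⁻¹ * z * q := by
    rw [← h1]
    group
  rw [h2, mul_assoc, ← Subgroup.mem_center_iff.1 z.2 q]
  group

variable (F)

open scoped IsMulCommutative in
/-- The functor `Z_F : O(F^c)ᵒᵖ → Ab` sending `P` to its centre and the class of `f : P → Q` to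
the homomorphism `f⁻¹ : Z(Q) → Z(P)`. -/
noncomputable def centerFunctor : (OrbitCat F)ᵒᵖ ⥤ CommGrpCat.{u} where
  obj P := CommGrpCat.of (Subgroup.center P.unop.sub)
  map {Q P} φ := CommGrpCat.ofHom
    (Quotient.lift (fun f => centerMap P.unop.centric f) (centerMap_congr P.unop.centric) φ.unop)
  map_id P := by
    refine CommGrpCat.hom_ext (MonoidHom.ext fun z => ?_)
    exact centerMap_eq_of_apply P.unop.centric
      ⟨MonoidHom.id P.unop.sub, F.id_mem P.unop.sub⟩ z z rfl
  map_comp := by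
    rintro ⟨R⟩ ⟨Q⟩ ⟨P⟩ ⟨γ⟩ ⟨φ⟩
    induction γ using Quotient.inductionOn with | _ g
    induction φ using Quotient.inductionOn with | _ f
    refine CommGrpCat.hom_ext (MonoidHom.ext fun z => ?_)
    refine centerMap_eq_of_apply P.centric
      ⟨g.1.comp f.1, F.comp_mem _ f.2 _ g.2⟩ z (centerMap P.centric f (centerMap Q.centric g z)) ?_
    rw [MonoidHom.comp_apply, apply_centerMap, apply_centerMap]

end FusionSystem

/-! ### Transporter systems and centric linking systems -/

/-- The members of a collection `H` of subgroups, as a type carrying no order, so that it can be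
the type of objects of a category. -/
structure SubgroupIn {S : Type u} [Group S] (H : Set (Subgroup S)) where
  sub : Subgroup S
  mem : sub ∈ H

/-- A category `T` whose objects are subgroups of `S`, with functors
`T_{Ob T}(S) --ε--> T --ρ--> F` that are the identity, respectively the inclusion, on objects. -/
structure TransporterData {S : Type u} [Group S] (F : FusionSystem S) where
  obj : Set (Subgroup S)
  cat : Category.{u} (SubgroupIn obj)
  ε : ∀ {P Q : SubgroupIn obj} (g : S), Transports g P.sub Q.sub → (P ⟶ Q)
  ε_id : ∀ P : SubgroupIn obj, ε (1 : S) (Transports.of_le (le_refl P.sub)) = 𝟙 P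
  ε_comp : ∀ {P Q R : SubgroupIn obj} (g h : S) (hg : Transports g P.sub Q.sub)
    (hh : Transports h Q.sub R.sub), ε (h * g) (hh.mul hg) = ε g hg ≫ ε h hh
  ρ : ∀ {P Q : SubgroupIn obj}, (P ⟶ Q) → (P.sub →* Q.sub)
  ρ_mem : ∀ {P Q : SubgroupIn obj} (φ : P ⟶ Q), ρ φ ∈ F.Hom P.sub Q.sub
  ρ_id : ∀ P : SubgroupIn obj, ρ (𝟙 P) = MonoidHom.id P.sub
  ρ_comp : ∀ {P Q R : SubgroupIn obj} (φ : P ⟶ Q) (ψ : Q ⟶ R), ρ (φ ≫ ψ) = (ρ ψ).comp (ρ φ)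

attribute [instance] TransporterData.cat

namespace TransporterData

variable {S : Type u} [Group S] {F : FusionSystem S} (T : TransporterData F)

/-- The homomorphism `ε_{P,P} : N_S(P) → Aut_T(P)`. -/
def εAut (P : SubgroupIn T.obj) : Subgroup.normalizer (P.sub : Set S) →* Aut P where
  toFun g :=
    { hom := T.ε g.1 (Transports.of_mem_normalizer g.2)
      inv := T.ε (g⁻¹).1 (Transports.of_mem_normalizer (g⁻¹).2)
      hom_inv_id := by
        rw [← T.ε_comp, ← T.ε_id]
        congr 1
        simp
      inv_hom_id := by
        rw [← T.ε_comp, ← T.ε_id]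
        congr 1
        simp }
  map_one' := by
    ext
    exact T.ε_id P
  map_mul' g h := by
    ext
    exact T.ε_comp _ _ _ _

/-- The homomorphism `Aut_T(P) → Aut(P)` induced by `ρ`. -/
def ρAut (P : SubgroupIn T.obj) : Aut P →* MulAut P.sub where
  toFun a := MonoidHom.toMulEquiv (T.ρ a.hom) (T.ρ a.inv)
    (by rw [← T.ρ_comp, a.hom_inv_id, T.ρ_id]) (by rw [← T.ρ_comp, a.inv_hom_id, T.ρ_id])
  map_one' := by
    ext x
    exact congrArg (fun f : P.sub →* P.sub => (f x : S)) (T.ρ_id P)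
  map_mul' a b := by
    ext x
    exact congrArg (fun f : P.sub →* P.sub => (f x : S)) (T.ρ_comp b.hom a.hom)

/-- `E(P) = Ker(Aut_T(P) → Aut_F(P))`. -/
def E (P : SubgroupIn T.obj) : Subgroup (Aut P) := (T.ρAut P).ker

/-- The inclusion morphism `ε_{P,Q}(1)` for `P ≤ Q`. -/
def incl {P Q : SubgroupIn T.obj} (h : P.sub ≤ Q.sub) : P ⟶ Q := T.ε 1 (Transports.of_le h)

/-- The axioms of a transporter system associated to `F`. -/
structure IsTransporterSystem (p : ℕ) : Prop where
  top_mem : ⊤ ∈ T.obj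
  conj_mem : ∀ P Q : Subgroup S, P ∈ T.obj → F.IsConj P Q → Q ∈ T.obj
  overgroup_mem : ∀ P Q : Subgroup S, P ∈ T.obj → P ≤ Q → Q ∈ T.obj
  free_right : ∀ {P Q : SubgroupIn T.obj} (φ : P ⟶ Q), ∀ a ∈ T.E P, a.hom ≫ φ = φ → a = 1
  ρ_surjective : ∀ {P Q : SubgroupIn T.obj}, ∀ f ∈ F.Hom P.sub Q.sub, ∃ φ : P ⟶ Q, T.ρ φ = f
  ρ_orbit : ∀ {P Q : SubgroupIn T.obj} (φ ψ : P ⟶ Q),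
    T.ρ φ = T.ρ ψ ↔ ∃ a ∈ T.E P, a.hom ≫ φ = ψ
  free_left : ∀ {P Q : SubgroupIn T.obj} (φ : P ⟶ Q), ∀ a ∈ T.E Q, φ ≫ a.hom = φ → a = 1
  ε_injective : ∀ {P Q : SubgroupIn T.obj} (g h : S) (hg : Transports g P.sub Q.sub)
    (hh : Transports h P.sub Q.sub), (T.ε g hg : P ⟶ Q) = T.ε h hh → g = h
  ρ_ε : ∀ {P Q : SubgroupIn T.obj} (g : S) (hg : Transports g P.sub Q.sub),
    T.ρ (T.ε g hg : P ⟶ Q) = conjHom g hg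
  comm : ∀ {P Q : SubgroupIn T.obj} (φ : P ⟶ Q) (g : P.sub),
    (T.εAut P ⟨g, Subgroup.le_normalizer g.2⟩).hom ≫ φ =
      φ ≫ (T.εAut Q ⟨T.ρ φ g, Subgroup.le_normalizer (T.ρ φ g).2⟩).hom
  sylow : IsSylowToral p (T.εAut ⟨⊤, top_mem⟩).range
  extension : ∀ {P P' R R' : SubgroupIn T.obj} (φ : P ≅ P') (hR : P.sub ≤ R.sub)
    (hR' : P'.sub ≤ R'.sub) (hN : R.sub ≤ Subgroup.normalizer (P.sub : Set S))
    (hN' : R'.sub ≤ Subgroup.normalizer (P'.sub : Set S)),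
    (∀ r : R.sub, ∃ r' : R'.sub,
      φ.inv ≫ (T.εAut P ⟨r, hN r.2⟩).hom ≫ φ.hom = (T.εAut P' ⟨r', hN' r'.2⟩).hom) →
    ∃ φ' : R ⟶ R', T.incl hR ≫ φ' = φ.hom ≫ T.incl hR'
  union : ∀ (P : ℕ → SubgroupIn T.obj) (hP : ∀ n, (P n).sub ≤ (P (n + 1)).sub)
    (φ : ∀ n, P n ⟶ (⟨⊤, top_mem⟩ : SubgroupIn T.obj)),
    (∀ n, φ n = T.incl (hP n) ≫ φ (n + 1)) →
    ∀ (Q : SubgroupIn T.obj) (hQ : Q.sub = ⨆ n, (P n).sub),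
      ∃ ψ : Q ⟶ (⟨⊤, top_mem⟩ : SubgroupIn T.obj),
        ∀ n, φ n = T.incl (hQ ▸ le_iSup (fun n => (P n).sub) n) ≫ ψ

/-- Centric linking systems: transporter systems whose objects are the `F`-centric subgroups and
for which `E(P) = ε(Z(P))`. -/
structure IsCentricLinkingSystem (p : ℕ) : Prop extends T.IsTransporterSystem p where
  obj_eq : T.obj = {P | F.IsCentric P}
  E_eq : ∀ P : SubgroupIn T.obj,
    T.E P = ((Subgroup.center P.sub).map (Subgroup.inclusion Subgroup.le_normalizer)).map (T.εAut P)

end TransporterData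

/-! ### `p`-local compact groups -/

/-- A `p`-local compact group `(S, F, L)` with Sylow subgroup `S`. -/
structure PLocalCompactGroup (p : ℕ) (S : Type u) [Group S] where
  toral : IsDiscretePToral p S
  F : FusionSystem S
  saturated : F.IsSaturated p
  L : TransporterData F
  linking : L.IsCentricLinkingSystem p

namespace PLocalCompactGroup

variable {p : ℕ} {S : Type u} [Group S] (𝒢 : PLocalCompactGroup p S)

/-- `S` as an object of the linking system. -/
def topL : SubgroupIn 𝒢.L.obj := ⟨⊤, 𝒢.linking.top_mem⟩

/-- `S` as an object of the centric orbit category. -/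
def topO : 𝒢.F.OrbitCat := ⟨⊤, by
  have h := 𝒢.linking.top_mem
  rw [𝒢.linking.obj_eq] at h
  exact h⟩

/-- The centre `Z(𝒢)`: the inverse limit of the centre functor over the centric orbit category. -/
noncomputable def centre : CommGrpCat.{u} := limit 𝒢.F.centerFunctor

/-- The structure map `ε_S : S → Aut_L(S)`. -/
def εTop : (⊤ : Subgroup S) →* Aut 𝒢.topL :=
  (𝒢.L.εAut 𝒢.topL).comp (Subgroup.inclusion Subgroup.le_normalizer)

/-- The canonical homomorphism `Z(𝒢) → Z(S) ≤ S → Aut_L(S)`. -/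
noncomputable def centreToAut : 𝒢.centre →* Aut 𝒢.topL :=
  (𝒢.εTop.comp (Subgroup.center (⊤ : Subgroup S)).subtype).comp
    (limit.π 𝒢.F.centerFunctor (Opposite.op 𝒢.topO)).hom

end PLocalCompactGroup

/-! ### Colimits of graphs of groups -/

section GraphColimit

variable {J : MultispanShape.{u, u}} (I : MultispanIndex J GrpCat.{u})

/-- The relations `fst n = snd n` in the free product of the vertex groups. -/
def graphRelations : Set (Monoid.CoprodI (fun b : J.R => I.right b)) :=
  {x | ∃ (a : J.L) (n : I.left a),
    x = (Monoid.CoprodI.of (M := fun b : J.R => I.right b) ((I.fst a).hom n)) *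
      (Monoid.CoprodI.of (M := fun b : J.R => I.right b) ((I.snd a).hom n))⁻¹}

/-- The free product of the vertex groups modulo the relations given by the edge groups. -/
abbrev GraphAmalgam : Type u :=
  Monoid.CoprodI (fun b : J.R => I.right b) ⧸ Subgroup.normalClosure (graphRelations I)

/-- The cocone exhibiting `GraphAmalgam` as a colimit. -/
def graphCocone : Multicofork I :=
  Multicofork.ofπ I (GrpCat.of (GraphAmalgam I))
    (fun b => GrpCat.ofHom ((QuotientGroup.mk' _).comp
      (Monoid.CoprodI.of (M := fun b : J.R => I.right b) (i := b)))) (by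
    intro a
    ext n
    refine (QuotientGroup.eq_iff_div_mem).2 ?_
    rw [div_eq_mul_inv]
    exact Subgroup.subset_normalClosure ⟨a, n, rfl⟩)

theorem graphCocone_lift_ker (K : Multicofork I) :
    Subgroup.normalClosure (graphRelations I) ≤
      (Monoid.CoprodI.lift (M := fun b : J.R => I.right b) (fun b => (K.π b).hom)).ker := by
  refine Subgroup.normalClosure_le_normal ?_
  rintro _ ⟨a, n, rfl⟩
  have h := congrArg (fun f => f.hom n) (K.condition a)
  change _ = 1
  rw [map_mul, map_inv, Monoid.CoprodI.lift_of, Monoid.CoprodI.lift_of, mul_inv_eq_one]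
  exact h

noncomputable def graphCocone_isColimit : IsColimit (graphCocone I) :=
  Multicofork.IsColimit.mk _
    (fun K => GrpCat.ofHom (QuotientGroup.lift _ _ (graphCocone_lift_ker I K)))
    (by
      intro K b
      ext x
      exact Monoid.CoprodI.lift_of (M := fun b : J.R => I.right b) (fun b => (K.π b).hom) x)
    (by
      intro K m hm
      ext1
      refine QuotientGroup.monoidHom_ext _ (Monoid.CoprodI.ext_hom _ _ fun b => ?_)
      ext x
      refine (congrArg (fun f => f.hom x) (hm b)).trans ?_
      exact (Monoid.CoprodI.lift_of (M := fun b : J.R => I.right b) (fun b => (K.π b).hom) x).symm)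

instance hasColimit_graph : HasColimit I.multispan := ⟨⟨⟨_, graphCocone_isColimit I⟩⟩⟩

end GraphColimit

/-! ### Robinson setups and Robinson amalgams -/

/-- A Robinson setup for `𝒢`: a fusion controlling family `fam` of objects of `L` and, for each
`P ∈ fam` with `P ≠ S`, a subgroup `N_P` of `L_P = Aut_L(P)`, with an embedding
`k_P : N_P → L_S = Aut_L(S)`, such that `N_S(P) ≤ N_P` compatibly with the embeddings of `N_S(P)`
in `Aut_L(P)` and in `Aut_L(S)`. -/
structure RobinsonSetup {p : ℕ} {S : Type u} [Group S] (𝒢 : PLocalCompactGroup p S) where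
  fam : Set (Subgroup S)
  controlling : 𝒢.F.IsFusionControlling p fam
  fam_subset : fam ⊆ 𝒢.L.obj
  N : ∀ P : SubgroupIn 𝒢.L.obj, P.sub ∈ fam → P.sub ≠ ⊤ → Subgroup (Aut P)
  k : ∀ (P : SubgroupIn 𝒢.L.obj) (hP : P.sub ∈ fam) (hS : P.sub ≠ ⊤), N P hP hS →* Aut 𝒢.topL
  k_injective : ∀ (P : SubgroupIn 𝒢.L.obj) (hP : P.sub ∈ fam) (hS : P.sub ≠ ⊤),
    Function.Injective (k P hP hS)
  normalizer_mem : ∀ (P : SubgroupIn 𝒢.L.obj) (hP : P.sub ∈ fam) (hS : P.sub ≠ ⊤)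
    (g : Subgroup.normalizer (P.sub : Set S)), 𝒢.L.εAut P g ∈ N P hP hS
  k_normalizer : ∀ (P : SubgroupIn 𝒢.L.obj) (hP : P.sub ∈ fam) (hS : P.sub ≠ ⊤)
    (g : Subgroup.normalizer (P.sub : Set S)),
    k P hP hS ⟨𝒢.L.εAut P g, normalizer_mem P hP hS g⟩ = 𝒢.εTop ⟨g, Subgroup.mem_top _⟩

namespace RobinsonSetup

variable {p : ℕ} {S : Type u} [Group S] {𝒢 : PLocalCompactGroup p S} (R : RobinsonSetup 𝒢)

/-- The vertices `v_P`, `P ∈ fam`, of the Robinson tree. -/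
abbrev Vertex : Type u := {P : SubgroupIn 𝒢.L.obj // P.sub ∈ R.fam}

/-- The edges `e_P`, `S ≠ P ∈ fam`, of the Robinson tree. -/
abbrev Edge : Type u := {P : SubgroupIn 𝒢.L.obj // P.sub ∈ R.fam ∧ P.sub ≠ ⊤}

/-- The vertex `v_S`. -/
def vTop : R.Vertex := ⟨𝒢.topL, R.controlling.top_mem⟩

/-- The Robinson tree: the edge `e_P` joins `v_S` with `v_P`. The associated category
`WalkingMultispan R.tree` has the vertices and edges as objects and, apart from identities, one
morphism from each edge to each of its two end points. -/
def tree : MultispanShape.{u, u} where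
  L := R.Edge
  R := R.Vertex
  fst := fun _ => R.vTop
  snd := fun e => ⟨e.1, e.2.1⟩

/-- The groups `L_P` on vertices and `N_P` on edges, with the maps
`k_P : N_P → L_S` and `j_P : N_P → L_P`. -/
def groups : MultispanIndex R.tree GrpCat.{u} where
  left := fun e : R.Edge => GrpCat.of (R.N e.1 e.2.1 e.2.2)
  right := fun v : R.Vertex => GrpCat.of (Aut v.1)
  fst := fun e : R.Edge => GrpCat.ofHom (R.k e.1 e.2.1 e.2.2)
  snd := fun e : R.Edge => GrpCat.ofHom (R.N e.1 e.2.1 e.2.2).subtype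

/-- The Robinson tree of groups, as a functor. -/
def treeOfGroups : WalkingMultispan R.tree ⥤ GrpCat.{u} := R.groups.multispan

instance : HasColimit R.treeOfGroups := hasColimit_graph R.groups

/-- The Robinson amalgam: the colimit of the Robinson tree of groups. -/
noncomputable def amalgam : GrpCat.{u} := colimit R.treeOfGroups

/-- The canonical homomorphism `L_P → G` for `P ∈ fam`. -/
noncomputable def ofVertex (v : R.Vertex) : Aut v.1 →* R.amalgam :=
  (colimit.ι R.treeOfGroups (WalkingMultispan.right v)).hom

/-- The canonical homomorphism `Z(𝒢) → Z(S) ≤ S → L_S → G`. -/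
noncomputable def centreToAmalgam : 𝒢.centre →* R.amalgam :=
  (R.ofVertex R.vTop).comp 𝒢.centreToAut

end RobinsonSetup

/-!
A central element of an amalgamated product has no reduced expression of length greater than one, so
a central element of `G` lies in some `L_P`. It commutes with `ε(P)`, hence lies in
`E(P) = ε(Z(P))`, and is the image of an element `z` of `S`, which is central in `S` and fixed by
`Aut_F(P)` for each `P` in the family that contains it. By Alperin's argument `z` is then fixed by
every morphism of `F` between centric subgroups, so that it is a component of an element of the
inverse limit `Z(𝒢)`. Conversely the components of an element of `Z(𝒢)` are all the same element of
`S`, and being fixed by `Aut_F(P)` it commutes with `L_P` for every `P` in the family.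

Since `S` is infinite in general, the choice of subgroups of greatest order in Alperin's argument is
made with respect to the order (rank, index of the maximal torus) of discrete `p`-toral groups.
-/

/-! ### Discrete `p`-tori -/

/-- The class of discrete `p`-tori `(ℤ/p^∞)^r`, described without coordinates as the divisible
abelian `p`-groups with finitely many elements of order `p`; see `isPTorus_iff`. It is a property
of a group that need not be commutative a priori, so that it applies to subgroups. -/
structure IsPTorus (p : ℕ) (D : Type*) [Group D] : Prop where
  isMulCommutative : IsMulCommutative D
  isPGroup : IsPGroup p D
  pow_surjective : Function.Surjective fun x : D => x ^ p
  finite_socle : {x : D | x ^ p = 1}.Finite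

section Torus

open scoped IsMulCommutative

theorem injective_of_eq_one_of_pow_eq_one {p : ℕ} {D E : Type*} [Group D] [Group E]
    (hD : IsPGroup p D) (f : D →* E) (h : ∀ x : D, x ^ p = 1 → f x = 1 → x = 1) :
    Function.Injective f := by
  rw [injective_iff_map_eq_one]
  intro x hx
  obtain ⟨k, hk⟩ := hD x
  induction k with
  | zero => simpa using hk
  | succ k ih =>
    exact ih (h _ (by rw [← pow_mul, ← pow_succ, hk]) (by rw [map_pow, hx, one_pow]))

theorem finite_setOf_pow_prime_pow_eq_one {p : ℕ} {D : Type*} [CommGroup D]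
    (h : {x : D | x ^ p = 1}.Finite) (k : ℕ) : {x : D | x ^ p ^ k = 1}.Finite := by
  induction k with
  | zero => simp
  | succ k ih =>
    have preimage_eq : {x : D | x ^ p ^ (k + 1) = 1} =
        (powMonoidHom p : D →* D) ⁻¹' {x | x ^ p ^ k = 1} := by
      ext x
      simp [pow_succ', pow_mul]
    rw [preimage_eq]
    refine ih.preimage' fun b _ => ?_
    rcases ((powMonoidHom p : D →* D) ⁻¹' {b}).eq_empty_or_nonempty with preimage_empty | ⟨a, rfl⟩
    · exact preimage_empty ▸ Set.finite_empty
    · have : Finite (powMonoidHom p : D →* D).ker := h.to_subtype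
      have := Finite.of_equiv _ (MonoidHom.fiberEquivKer (powMonoidHom p : D →* D) a).symm
      exact Set.toFinite _

theorem nonempty_mulEquiv_of_pow_prime_eq_one {p : ℕ} [Fact p.Prime] {A B : Type*} [CommGroup A]
    [CommGroup B] [Finite A] [Finite B] (hA : ∀ x : A, x ^ p = 1) (hB : ∀ x : B, x ^ p = 1)
    (h : Nat.card A = Nat.card B) : Nonempty (A ≃* B) := by
  let _ : Module (ZMod p) (Additive A) := AddCommGroup.zmodModule (n := p) fun x => hA x.toMul
  let _ : Module (ZMod p) (Additive B) := AddCommGroup.zmodModule (n := p) fun x => hB x.toMul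
  have finrank_eq :
      Module.finrank (ZMod p) (Additive A) = Module.finrank (ZMod p) (Additive B) := by
    refine Nat.pow_right_injective (Fact.out : p.Prime).two_le ?_
    calc p ^ Module.finrank (ZMod p) (Additive A) = Nat.card (Additive A) := by
          rw [Module.natCard_eq_pow_finrank (K := ZMod p), Nat.card_zmod]
      _ = Nat.card (Additive B) := h
      _ = p ^ Module.finrank (ZMod p) (Additive B) := by
          rw [Module.natCard_eq_pow_finrank (K := ZMod p), Nat.card_zmod]
  exact ⟨MulEquiv.toAdditive.symm (LinearEquiv.ofFinrankEq _ _ finrank_eq).toAddEquiv⟩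

namespace IsPTorus

variable {p : ℕ} {D E : Type*} [Group D] [Group E]

theorem finite_setOf_pow_eq_one (hD : IsPTorus p D) (k : ℕ) : {x : D | x ^ p ^ k = 1}.Finite :=
  have := hD.isMulCommutative
  finite_setOf_pow_prime_pow_eq_one hD.finite_socle k

theorem of_mulEquiv (hD : IsPTorus p D) (e : D ≃* E) : IsPTorus p E where
  isMulCommutative := ⟨⟨fun x y => e.symm.injective (by
    have := hD.isMulCommutative
    rw [map_mul, map_mul, mul_comm])⟩⟩
  isPGroup := hD.isPGroup.of_equiv e
  pow_surjective := fun x => by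
    obtain ⟨y, hy⟩ := hD.pow_surjective (e.symm x)
    exact ⟨e y, by simpa using congrArg e hy⟩
  finite_socle := (hD.finite_socle.image e).subset fun x (hx : x ^ p = 1) =>
    ⟨e.symm x, by simp [← map_pow, hx], e.apply_symm_apply x⟩

theorem pow_surjective_of_ne_zero [hp : Fact p.Prime] (hD : IsPTorus p D) {n : ℕ} (hn : n ≠ 0) :
    Function.Surjective fun x : D => x ^ n := by
  obtain ⟨a, m, hm, rfl⟩ := Nat.exists_eq_pow_mul_and_not_dvd hn p hp.out.ne_one
  have pow_surj : Function.Surjective fun x : D => x ^ p ^ a := by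
    simpa only [pow_iterate] using hD.pow_surjective.iterate a
  have coprime_surj : Function.Surjective fun x : D => x ^ m :=
    (hD.isPGroup.powEquiv ((Nat.Prime.coprime_iff_not_dvd hp.out).2 hm)).surjective
  simpa only [Function.comp_def, ← pow_mul] using coprime_surj.comp pow_surj

theorem hom_eq_one_of_finite [Fact p.Prime] (hD : IsPTorus p D) [Finite E] (f : D →* E) :
    f = 1 := by
  ext x
  obtain ⟨y, rfl⟩ := hD.pow_surjective_of_ne_zero (Nat.card_pos (α := E)).ne' x
  simp

theorem le_of_index_ne_zero [Fact p.Prime] {T A : Subgroup E} (hT : IsPTorus p T)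
    (hA : A.index ≠ 0) : T ≤ A := by
  have : A.FiniteIndex := ⟨hA⟩
  intro t ht
  have h := DFunLike.congr_fun
    (hT.hom_eq_one_of_finite ((QuotientGroup.mk' A.normalCore).comp T.subtype)) ⟨t, ht⟩
  exact A.normalCore_le ((QuotientGroup.eq_one_iff t).1 h)

/-- Divisible abelian groups are injective. -/
theorem exists_extension [Fact p.Prime] (hD : IsPTorus p D) {B : Type*} [CommGroup B]
    (A : Subgroup B) (f : A →* D) : ∃ g : B →* D, ∀ a : A, g a = f a := by
  have := hD.isMulCommutative
  let _ : DivisibleBy (Additive D) ℕ :=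
    divisibleByOfSMulRightSurj _ _ fun hn => hD.pow_surjective_of_ne_zero hn
  let _ : DivisibleBy (Additive D) ℤ := AddGroup.divisibleByIntOfDivisibleByNat _
  obtain ⟨g, hg⟩ := (Module.Baer.of_divisible (Additive D)).extension_property_addMonoidHom
    (MonoidHom.toAdditive A.subtype) A.subtype_injective (MonoidHom.toAdditive f)
  exact ⟨MonoidHom.toAdditive.symm g, fun a => DFunLike.congr_fun hg a⟩

theorem surjective_of_injective (hD : IsPTorus p D) {f : D →* D} (hf : Function.Injective f) :
    Function.Surjective f := by
  intro x
  obtain ⟨k, hk⟩ := hD.isPGroup x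
  have image_subset : f '' {x | x ^ p ^ k = 1} ⊆ {x | x ^ p ^ k = 1} := by
    rintro _ ⟨y, hy : y ^ p ^ k = 1, rfl⟩
    exact show f y ^ p ^ k = 1 by rw [← map_pow, hy, map_one]
  have image_eq := Set.eq_of_subset_of_ncard_le image_subset
    (Set.ncard_image_of_injective _ hf).ge (hD.finite_setOf_pow_eq_one k)
  obtain ⟨y, -, hy⟩ := image_eq.ge hk
  exact ⟨y, hy⟩

theorem exists_injective_of_socle_equiv [Fact p.Prime] [IsMulCommutative D] (hD : IsPTorus p D)
    [IsMulCommutative E] (hE : IsPTorus p E)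
    (e : (powMonoidHom p : D →* D).ker ≃* (powMonoidHom p : E →* E).ker) :
    ∃ f : D →* E, Function.Injective f := by
  obtain ⟨f, hf⟩ := hE.exists_extension _ ((Subgroup.subtype _).comp e.toMonoidHom)
  refine ⟨f, injective_of_eq_one_of_pow_eq_one hD.isPGroup f fun x hx hfx => ?_⟩
  have he : e ⟨x, hx⟩ = 1 := Subtype.ext ((hf ⟨x, hx⟩).symm.trans hfx)
  exact congrArg Subtype.val ((map_eq_one_iff e e.injective).1 he)

theorem nonempty_mulEquiv [Fact p.Prime] (hD : IsPTorus p D) (hE : IsPTorus p E)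
    (h : {x : D | x ^ p = 1}.ncard = {x : E | x ^ p = 1}.ncard) : Nonempty (D ≃* E) := by
  have := hD.isMulCommutative
  have := hE.isMulCommutative
  have : Finite (powMonoidHom p : D →* D).ker := hD.finite_socle.to_subtype
  have : Finite (powMonoidHom p : E →* E).ker := hE.finite_socle.to_subtype
  obtain ⟨e⟩ : Nonempty ((powMonoidHom p : D →* D).ker ≃* (powMonoidHom p : E →* E).ker) :=
    nonempty_mulEquiv_of_pow_prime_eq_one (p := p) (fun x => Subtype.ext x.2)
      (fun x => Subtype.ext x.2) h
  obtain ⟨f, hf⟩ := hD.exists_injective_of_socle_equiv hE e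
  obtain ⟨g, hg⟩ := hE.exists_injective_of_socle_equiv hD e.symm
  have comp_surjective : Function.Surjective (f ∘ g) :=
    hE.surjective_of_injective (f := f.comp g) (hf.comp hg)
  exact ⟨MulEquiv.ofBijective f ⟨hf, comp_surjective.of_comp⟩⟩

theorem pi {ι : Type*} [Finite ι] {D : ι → Type*} [∀ i, Group (D i)]
    (hD : ∀ i, IsPTorus p (D i)) : IsPTorus p (∀ i, D i) where
  isMulCommutative := ⟨⟨fun x y => funext fun i => by
    have := (hD i).isMulCommutative
    exact mul_comm (x i) (y i)⟩⟩
  isPGroup x := by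
    have := Fintype.ofFinite ι
    choose k hk using fun i => (hD i).isPGroup (x i)
    refine ⟨∑ i, k i, funext fun i => ?_⟩
    obtain ⟨d, hd⟩ := pow_dvd_pow p (Finset.single_le_sum (fun _ _ => Nat.zero_le _)
      (Finset.mem_univ i) : k i ≤ ∑ i, k i)
    rw [Pi.pow_apply, hd, pow_mul, hk, one_pow, Pi.one_apply]
  pow_surjective := Function.Surjective.piMap fun i => (hD i).pow_surjective
  finite_socle := (Set.Finite.pi' fun i => (hD i).finite_socle).subset
    fun _ hx i => congrFun hx i

end IsPTorus

section Prufer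

variable (p : ℕ) [hp : Fact p.Prime]

theorem ncard_socle_pruferGroup : {x : PruferGroup p | x ^ p = 1}.ncard = p := by
  have : NeZero p := ⟨hp.out.ne_zero⟩
  have image_eq : Subtype.val '' {x : PruferGroup p | x ^ p = 1} = rootsOfUnity p ℂ := by
    ext x
    constructor
    · rintro ⟨y, hy, rfl⟩
      exact congrArg Subtype.val hy
    · intro hx
      exact ⟨⟨x, CommGroup.mem_primaryComponent.2 ⟨1, by rw [pow_one]; exact hx⟩⟩,
        Subtype.ext hx, rfl⟩
  rw [← Set.ncard_image_of_injective _ Subtype.val_injective, image_eq,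
    ← Nat.card_coe_set_eq]
  exact Complex.card_rootsOfUnity p

theorem isPTorus_pruferGroup : IsPTorus p (PruferGroup p) where
  isMulCommutative := ⟨⟨mul_comm⟩⟩
  isPGroup x := (CommGroup.mem_primaryComponent.1 x.2).imp fun _ hk => Subtype.ext hk
  pow_surjective := by
    rintro ⟨a, ha⟩
    obtain ⟨c, hc⟩ := IsAlgClosed.exists_pow_nat_eq (a : ℂ) hp.out.pos
    have hc0 : c ≠ 0 := by
      rintro rfl
      exact a.ne_zero (by rw [← hc, zero_pow hp.out.ne_zero])
    have hca : Units.mk0 c hc0 ^ p = a := Units.ext (by simpa using hc)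
    obtain ⟨k, hk⟩ := CommGroup.mem_primaryComponent.1 ha
    exact ⟨⟨Units.mk0 c hc0, CommGroup.mem_primaryComponent.2
      ⟨k + 1, by rw [pow_succ', pow_mul, hca, hk]⟩⟩, Subtype.ext hca⟩
  finite_socle := Set.finite_of_ncard_ne_zero (by
    rw [ncard_socle_pruferGroup]
    exact hp.out.ne_zero)

theorem ncard_socle_pi_pruferGroup (r : ℕ) :
    {x : Fin r → PruferGroup p | x ^ p = 1}.ncard = p ^ r := by
  have : {x : Fin r → PruferGroup p | x ^ p = 1} =
      Set.univ.pi fun _ => {x : PruferGroup p | x ^ p = 1} := by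
    ext x
    simp [funext_iff]
  rw [this, ← Nat.card_coe_set_eq, Nat.card_congr (Equiv.Set.univPi _), Nat.card_pi]
  simp [ncard_socle_pruferGroup]

variable {p}

theorem isPTorus_iff {D : Type*} [Group D] :
    IsPTorus p D ↔ ∃ r : ℕ, Nonempty (D ≃* (Fin r → PruferGroup p)) := by
  have isPTorus_pi r : IsPTorus p (Fin r → PruferGroup p) := .pi fun _ => isPTorus_pruferGroup p
  refine ⟨fun hD => ?_, fun ⟨r, ⟨e⟩⟩ => (isPTorus_pi r).of_mulEquiv e.symm⟩
  have := hD.isMulCommutative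
  have : Finite (powMonoidHom p : D →* D).ker := hD.finite_socle.to_subtype
  obtain ⟨r, hr⟩ := IsPGroup.iff_card.1 (hD.isPGroup.to_subgroup (powMonoidHom p : D →* D).ker)
  exact ⟨r, hD.nonempty_mulEquiv (isPTorus_pi r)
    ((ncard_socle_pi_pruferGroup p r).symm ▸ hr)⟩

theorem ncard_socle_of_mulEquiv {D : Type*} [Group D] {r : ℕ} (e : D ≃* (Fin r → PruferGroup p)) :
    {x : D | x ^ p = 1}.ncard = p ^ r := by
  rw [← ncard_socle_pi_pruferGroup, ← Set.ncard_image_of_injective _ e.injective]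
  congr 1
  ext x
  constructor
  · rintro ⟨y, hy : y ^ p = 1, rfl⟩
    exact show e y ^ p = 1 by rw [← map_pow, hy, map_one]
  · intro hx
    exact ⟨e.symm x, show e.symm x ^ p = 1 by rw [← map_pow, hx, map_one], e.apply_symm_apply x⟩

end Prufer

end Torus

/-! ### Orders of discrete `p`-toral groups -/

section ToralOrder

variable {p : ℕ} {P Q : Type*} [Group P] [Group Q] {r m s n : ℕ}

theorem HasToralOrder.of_mulEquiv (e : P ≃* Q) (h : HasToralOrder p P r m) :
    HasToralOrder p Q r m := by
  obtain ⟨T, hT, ⟨f⟩, hm, ha⟩ := h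
  exact ⟨T.map e.toMonoidHom, hT.map _ e.surjective,
    ⟨(T.equivMapOfInjective e.toMonoidHom e.injective).symm.trans f⟩,
    (Subgroup.index_map_equiv T e).trans hm, ha⟩

variable [hp : Fact p.Prime]

theorem rank_le_of_injective (e : P ≃* (Fin r → PruferGroup p)) (f : Q ≃* (Fin s → PruferGroup p))
    {g : P →* Q} (hg : Function.Injective g) : r ≤ s := by
  have hQ : IsPTorus p Q := isPTorus_iff.2 ⟨s, ⟨f⟩⟩
  have image_subset : g '' {x | x ^ p = 1} ⊆ {x | x ^ p = 1} := by
    rintro _ ⟨y, hy : y ^ p = 1, rfl⟩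
    exact show g y ^ p = 1 by rw [← map_pow, hy, map_one]
  have ncard_le := Set.ncard_le_ncard image_subset hQ.finite_socle
  rw [Set.ncard_image_of_injective _ hg, ncard_socle_of_mulEquiv e, ncard_socle_of_mulEquiv f]
    at ncard_le
  exact (Nat.pow_le_pow_iff_right hp.out.one_lt).1 ncard_le

theorem surjective_of_injective_of_rank_eq (e : P ≃* (Fin r → PruferGroup p))
    (f : Q ≃* (Fin r → PruferGroup p)) {g : P →* Q} (hg : Function.Injective g) :
    Function.Surjective g := by
  have hP : IsPTorus p P := isPTorus_iff.2 ⟨r, ⟨e⟩⟩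
  have h : Function.Surjective ((f.trans e.symm) ∘ g) :=
    hP.surjective_of_injective (f := (f.trans e.symm).toMonoidHom.comp g)
      ((f.trans e.symm).injective.comp hg)
  exact h.of_comp_left (f.trans e.symm).injective

namespace HasToralOrder

theorem ne_zero (h : HasToralOrder p P r m) : m ≠ 0 := by
  obtain ⟨-, -, -, -, a, rfl⟩ := h
  exact pow_ne_zero a hp.out.ne_zero

theorem lt_or_eq_mul_index (hP : HasToralOrder p P r m) (hQ : HasToralOrder p Q s n)
    {i : P →* Q} (hi : Function.Injective i) : r < s ∨ (r = s ∧ n = m * i.range.index) := by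
  have hn := hQ.ne_zero
  obtain ⟨T, -, ⟨e⟩, rfl, -⟩ := hP
  obtain ⟨U, -, ⟨f⟩, rfl, -⟩ := hQ
  let eT := (T.equivMapOfInjective i hi).symm.trans e
  have map_le : T.map i ≤ U := (isPTorus_iff.2 ⟨r, ⟨eT⟩⟩).le_of_index_ne_zero hn
  have inclusion_injective := Subgroup.inclusion_injective map_le
  refine (rank_le_of_injective eT f inclusion_injective).lt_or_eq.imp_right ?_
  rintro rfl
  have map_eq : T.map i = U := le_antisymm map_le fun x hx => by
    obtain ⟨y, hy⟩ := surjective_of_injective_of_rank_eq eT f inclusion_injective ⟨x, hx⟩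
    obtain rfl : (y : Q) = x := congrArg Subtype.val hy
    exact y.2
  exact ⟨rfl, by rw [← map_eq, Subgroup.index_map_of_injective T hi]⟩

theorem eq_mul_index_of_ne_zero (hP : HasToralOrder p P r m) (hQ : HasToralOrder p Q s n)
    {i : P →* Q} (hi : Function.Injective i) (index_ne_zero : i.range.index ≠ 0) :
    r = s ∧ n = m * i.range.index := by
  refine (hP.lt_or_eq_mul_index hQ hi).resolve_left fun hlt => hlt.not_ge ?_
  have hm := hP.ne_zero
  obtain ⟨T, -, ⟨e⟩, rfl, -⟩ := hP
  obtain ⟨U, -, ⟨f⟩, -⟩ := hQ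
  have le_map : U ≤ T.map i := (isPTorus_iff.2 ⟨s, ⟨f⟩⟩).le_of_index_ne_zero (by
    rw [Subgroup.index_map_of_injective T hi]
    exact mul_ne_zero hm index_ne_zero)
  exact rank_le_of_injective f ((T.equivMapOfInjective i hi).symm.trans e)
    (Subgroup.inclusion_injective le_map)

theorem unique (h : HasToralOrder p P r m) (h' : HasToralOrder p P s n) : r = s ∧ m = n := by
  have index_eq : (MonoidHom.id P).range.index = 1 :=
    Subgroup.index_eq_one.2 (MonoidHom.range_eq_top.2 Function.surjective_id)
  obtain ⟨hr, hm⟩ := h.eq_mul_index_of_ne_zero h' (i := MonoidHom.id P) Function.injective_id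
    (index_eq ▸ one_ne_zero)
  exact ⟨hr, by rw [hm, index_eq, mul_one]⟩

end HasToralOrder

theorem isDiscretePToral_iff : IsDiscretePToral p P ↔
    IsPGroup p P ∧ ∃ T : Subgroup P, T.Normal ∧ IsPTorus p T ∧ T.index ≠ 0 := by
  constructor
  · rintro ⟨r, m, h⟩
    have hm := h.ne_zero
    obtain ⟨T, hT, he, rfl, a, ha⟩ := h
    have isPTorus : IsPTorus p T := isPTorus_iff.2 ⟨r, he⟩
    refine ⟨fun x => ?_, T, hT, isPTorus, hm⟩
    obtain ⟨k, hk⟩ := isPTorus.isPGroup ⟨_, T.pow_index_mem x⟩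
    exact ⟨a + k, by rw [pow_add, pow_mul, ← ha]; exact congrArg Subtype.val hk⟩
  · rintro ⟨hP, T, hT, isPTorus, index_ne_zero⟩
    obtain ⟨r, he⟩ := isPTorus_iff.1 isPTorus
    have : T.FiniteIndex := ⟨index_ne_zero⟩
    exact ⟨r, T.index, T, hT, he, rfl, hP.index T⟩

theorem isDiscretePToral_of_isPGroup [Finite P] (hP : IsPGroup p P) : IsDiscretePToral p P :=
  isDiscretePToral_iff.2 ⟨hP, ⊥, inferInstance,
    isPTorus_iff.2 ⟨0, ⟨MulEquiv.ofUnique⟩⟩, Subgroup.index_ne_zero_of_finite⟩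

end ToralOrder

section Subgroups

open scoped IsMulCommutative

variable {p : ℕ}

theorem exists_mem_range_pow_pow_eq {A : Type*} [CommGroup A] (hA : IsPGroup p A) {n : ℕ}
    (h : ∀ k, ∀ x ∈ (powMonoidHom (p ^ n) : A →* A).range, x ^ p = 1 →
      x ∈ (powMonoidHom (p ^ (n + k)) : A →* A).range) :
    ∀ x ∈ (powMonoidHom (p ^ n) : A →* A).range,
      ∃ y ∈ (powMonoidHom (p ^ n) : A →* A).range, y ^ p = x := by
  set D := (powMonoidHom (p ^ n) : A →* A).range
  suffices key : ∀ j, ∀ x ∈ D, x ^ p ^ j = 1 → ∃ y ∈ D, y ^ p = x from fun x hx =>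
    let ⟨j, hj⟩ := hA x
    key j x hx hj
  intro j
  induction j with
  | zero => exact fun x _ hx => ⟨1, D.one_mem, by simpa [eq_comm] using hx⟩
  | succ j ih =>
    intro x hx hxj
    obtain ⟨a, ha⟩ := h (j + 1) (x ^ p ^ j) (D.pow_mem hx _) (by rw [← pow_mul, ← pow_succ, hxj])
    have hc : a ^ p ^ n ∈ D := ⟨a, rfl⟩
    have pow_eq : ((a ^ p ^ n) ^ p) ^ p ^ j = x ^ p ^ j := by
      rw [← ha, powMonoidHom_apply, ← pow_mul, ← pow_mul, pow_add, pow_succ']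
    obtain ⟨y, hy, hyx⟩ := ih (x / (a ^ p ^ n) ^ p) (D.div_mem hx (D.pow_mem hc p))
      (by rw [div_pow, pow_eq, div_self'])
    exact ⟨y * a ^ p ^ n, D.mul_mem hy hc, by rw [mul_pow, hyx, div_mul_cancel]⟩

variable [hp : Fact p.Prime]

theorem index_range_powMonoidHom_ne_zero {A : Type*} [CommGroup A]
    (hfin : {x : A | x ^ p = 1}.Finite) {n : ℕ}
    (hD : IsPTorus p (powMonoidHom (p ^ n) : A →* A).range) :
    (powMonoidHom (p ^ n) : A →* A).range.index ≠ 0 := by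
  set D := (powMonoidHom (p ^ n) : A →* A).range
  have := (finite_setOf_pow_prime_pow_eq_one hfin n).to_subtype
  have : Finite (A ⧸ D) := by
    refine Finite.of_surjective (fun x : {x : A | x ^ p ^ n = 1} => (x.1 : A ⧸ D)) fun q => ?_
    obtain ⟨a, rfl⟩ := QuotientGroup.mk_surjective q
    obtain ⟨d, hd⟩ := hD.pow_surjective_of_ne_zero (pow_ne_zero n hp.out.ne_zero)
      ⟨a ^ p ^ n, a, rfl⟩
    have hd : (d : A) ^ p ^ n = a ^ p ^ n := congrArg Subtype.val hd
    refine ⟨⟨a / d, show (a / d : A) ^ p ^ n = 1 by rw [div_pow, hd, div_self']⟩,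
      QuotientGroup.eq.2 ?_⟩
    simp
  exact Subgroup.index_ne_zero_of_finite

theorem exists_isPTorus_range_powMonoidHom {A : Type*} [CommGroup A] (hA : IsPGroup p A)
    (hfin : {x : A | x ^ p = 1}.Finite) :
    ∃ n, IsPTorus p (powMonoidHom (p ^ n) : A →* A).range ∧
      (powMonoidHom (p ^ n) : A →* A).range.index ≠ 0 := by
  let socle (n : ℕ) : Set A := {x | x ∈ (powMonoidHom (p ^ n) : A →* A).range ∧ x ^ p = 1}
  have socle_finite n : (socle n).Finite := hfin.subset fun x hx => hx.2
  have socle_anti n k : socle (n + k) ⊆ socle n := by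
    rintro _ ⟨⟨a, rfl⟩, hx⟩
    exact ⟨⟨a ^ p ^ k, by simp [← pow_mul, pow_add, mul_comm]⟩, hx⟩
  let n := Function.argmin fun n => (socle n).ncard
  have socle_eq k : socle (n + k) = socle n :=
    Set.eq_of_subset_of_ncard_le (socle_anti n k)
      (Function.argmin_le (fun n => (socle n).ncard) (n + k)) (socle_finite n)
  have isPTorus : IsPTorus p (powMonoidHom (p ^ n) : A →* A).range :=
    { isMulCommutative := inferInstance
      isPGroup := hA.to_subgroup _
      pow_surjective := fun x => by
        obtain ⟨y, hy, hyx⟩ := exists_mem_range_pow_pow_eq hA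
          (fun k x hx hxp => ((socle_eq k).ge ⟨hx, hxp⟩).1) x x.2
        exact ⟨⟨y, hy⟩, Subtype.ext hyx⟩
      finite_socle := Set.Finite.preimage Subtype.val_injective.injOn hfin |>.subset
        fun x hx => congrArg Subtype.val hx }
  exact ⟨n, isPTorus, index_range_powMonoidHom_ne_zero hfin isPTorus⟩

namespace IsDiscretePToral

variable {P Q : Type*} [Group P] [Group Q]

theorem isPGroup (hP : IsDiscretePToral p P) : IsPGroup p P := (isDiscretePToral_iff.1 hP).1

theorem of_injective (hP : IsDiscretePToral p P) {i : Q →* P} (hi : Function.Injective i) :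
    IsDiscretePToral p Q := by
  obtain ⟨isPGroup, T, hT, isPTorus, index_ne_zero⟩ := isDiscretePToral_iff.1 hP
  have := isPTorus.isMulCommutative
  let A := T.comap i
  have index_A : A.index ≠ 0 :=
    T.index_comap i ▸ ne_zero_of_dvd_ne_zero index_ne_zero (T.relIndex_dvd_index_of_normal i.range)
  let j : A →* T := i.subgroupComap T
  have hj : Function.Injective j := fun x y h => Subtype.ext (hi (congrArg Subtype.val h))
  have : IsMulCommutative A := ⟨⟨fun x y => hj (by rw [map_mul, map_mul, mul_comm])⟩⟩
  have hQ := isPGroup.of_injective i hi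
  obtain ⟨n, hD, index_D⟩ := exists_isPTorus_range_powMonoidHom (hQ.to_subgroup A)
    (isPTorus.finite_socle.preimage hj.injOn |>.subset fun x (hx : x ^ p = 1) =>
      show j x ^ p = 1 by rw [← map_pow, hx, map_one])
  have : (powMonoidHom (p ^ n) : A →* A).range.Characteristic :=
    Subgroup.characteristic_iff_map_le.2 fun φ => by
      rintro _ ⟨_, ⟨a, rfl⟩, rfl⟩
      exact ⟨φ a, (map_pow φ a _).symm⟩
  refine isDiscretePToral_iff.2 ⟨hQ, (powMonoidHom (p ^ n) : A →* A).range.map A.subtype,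
    ConjAct.normal_of_characteristic_of_normal, hD.of_mulEquiv
      (Subgroup.equivMapOfInjective _ A.subtype A.subtype_injective), ?_⟩
  rw [Subgroup.index_map_subtype]
  exact mul_ne_zero index_D index_A

theorem to_subgroup (hP : IsDiscretePToral p P) (H : Subgroup P) : IsDiscretePToral p H :=
  hP.of_injective H.subtype_injective

end IsDiscretePToral

end Subgroups

section Comparison

variable {p : ℕ}

namespace ToralOrderLE

variable {P Q R P' Q' : Type*} [Group P] [Group Q] [Group R] [Group P'] [Group Q']

theorem congr (e : P ≃* P') (f : Q ≃* Q') (h : ToralOrderLE p P Q) : ToralOrderLE p P' Q' := by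
  obtain ⟨r, m, s, n, hP, hQ, hle⟩ := h
  exact ⟨r, m, s, n, hP.of_mulEquiv e, hQ.of_mulEquiv f, hle⟩

variable [Fact p.Prime]

theorem trans (h : ToralOrderLE p P Q) (h' : ToralOrderLE p Q R) : ToralOrderLE p P R := by
  obtain ⟨r, m, s, n, hP, hQ, hle⟩ := h
  obtain ⟨s', n', k, l, hQ', hR, hle'⟩ := h'
  obtain ⟨rfl, rfl⟩ := hQ.unique hQ'
  exact ⟨r, m, k, l, hP, hR, by omega⟩

theorem surjective_of_injective (h : ToralOrderLE p Q P) {i : P →* Q}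
    (hi : Function.Injective i) : Function.Surjective i := by
  obtain ⟨s, n, r, m, hQ, hP, hle⟩ := h
  have hlt := hP.lt_or_eq_mul_index hQ hi
  have hm := Nat.pos_of_ne_zero hP.ne_zero
  have hn := hQ.ne_zero
  obtain ⟨-, rfl⟩ := hlt.resolve_left (by omega)
  rw [← MonoidHom.range_eq_top, ← Subgroup.index_eq_one]
  have index_le_one : i.range.index ≤ 1 := Nat.le_of_mul_le_mul_left (by omega) hm
  exact index_le_one.antisymm (Nat.one_le_iff_ne_zero.2 (right_ne_zero_of_mul hn))

end ToralOrderLE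

variable [Fact p.Prime]

theorem IsDiscretePToral.toralOrderLE_of_injective {P Q : Type*} [Group P] [Group Q]
    (hQ : IsDiscretePToral p Q) {i : P →* Q} (hi : Function.Injective i) : ToralOrderLE p P Q := by
  obtain ⟨r, m, hP⟩ := hQ.of_injective hi
  obtain ⟨s, n, hQ⟩ := hQ
  have hn := hQ.ne_zero
  refine ⟨r, m, s, n, hP, hQ, (hP.lt_or_eq_mul_index hQ hi).imp_right ?_⟩
  rintro ⟨rfl, rfl⟩
  exact ⟨rfl, Nat.le_mul_of_pos_right m (Nat.pos_of_ne_zero (right_ne_zero_of_mul hn))⟩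

variable {S : Type*} [Group S] {H K : Subgroup S}

theorem IsDiscretePToral.toralOrderLE_of_le (hS : IsDiscretePToral p S) (h : H ≤ K) :
    ToralOrderLE p H K :=
  (hS.to_subgroup K).toralOrderLE_of_injective (Subgroup.inclusion_injective h)

theorem eq_of_le_of_toralOrderLE (h : H ≤ K) (hKH : ToralOrderLE p K H) : H = K :=
  le_antisymm h fun x hx => by
    obtain ⟨y, hy⟩ := hKH.surjective_of_injective (Subgroup.inclusion_injective h) ⟨x, hx⟩
    obtain rfl : (y : S) = x := congrArg Subtype.val hy
    exact y.2

end Comparison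

section NormalizerCondition

open scoped IsMulCommutative

variable {p : ℕ} [hp : Fact p.Prime] {S : Type*} [Group S] {H : Subgroup S}

theorem lt_normalizer_of_index_ne_zero (hS : IsPGroup p S) (index_ne_zero : H.index ≠ 0)
    (hH : H ≠ ⊤) : H < Subgroup.normalizer (H : Set S) := by
  have : H.FiniteIndex := ⟨index_ne_zero⟩
  let π := QuotientGroup.mk' H.normalCore
  have hπ : Function.Surjective π := QuotientGroup.mk'_surjective _
  have comap_map : (H.map π).comap π = H :=
    Subgroup.comap_map_eq_self (by rw [QuotientGroup.ker_mk']; exact H.normalCore_le)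
  have := (hS.to_quotient H.normalCore).isNilpotent
  have map_lt : H.map π < Subgroup.normalizer (H.map π : Set (S ⧸ H.normalCore)) := by
    refine Group.normalizerCondition_of_isNilpotent _ (lt_top_iff_ne_top.2 fun h => hH ?_)
    rw [← comap_map, h, Subgroup.comap_top]
  have comap_lt := (Subgroup.comap_lt_comap_of_surjective hπ).2 map_lt
  rwa [Subgroup.comap_normalizer_eq_of_surjective _ hπ, comap_map] at comap_lt

theorem relIndex_sup_ne_zero (H : Subgroup S) {X : Subgroup S} [X.Normal] [Finite X] :
    H.relIndex (H ⊔ X) ≠ 0 := by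
  have : Finite (↥(H ⊔ X) ⧸ H.subgroupOf (H ⊔ X)) := by
    refine Finite.of_surjective
      (fun x : X => QuotientGroup.mk ⟨x, (le_sup_right : X ≤ H ⊔ X) x.2⟩) fun q => ?_
    obtain ⟨⟨y, hy⟩, rfl⟩ := QuotientGroup.mk_surjective q
    obtain ⟨x, hx, h, hh, rfl⟩ := Subgroup.mem_sup_of_normal_left.1 (sup_comm H X ▸ hy)
    refine ⟨⟨x, hx⟩, QuotientGroup.eq.2 (Subgroup.mem_subgroupOf.2 ?_)⟩
    simpa using hh
  exact Subgroup.index_ne_zero_of_finite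

namespace IsDiscretePToral

theorem exists_gt_relIndex_ne_zero (hS : IsDiscretePToral p S) (hH : H ≠ ⊤) :
    ∃ K, H < K ∧ H.relIndex K ≠ 0 := by
  obtain ⟨-, T, hTn, hT, hT0⟩ := isDiscretePToral_iff.1 hS
  by_cases hTH : T ≤ H
  · refine ⟨⊤, lt_top_iff_ne_top.2 hH, ?_⟩
    rw [Subgroup.relIndex_top_right]
    exact ne_zero_of_dvd_ne_zero hT0 (Subgroup.index_dvd_of_le hTH)
  · obtain ⟨t, htT, htH⟩ := SetLike.not_le_iff_exists.1 hTH
    obtain ⟨k, hk⟩ := hT.isPGroup ⟨t, htT⟩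
    have := hT.isMulCommutative
    let torsion := (powMonoidHom (p ^ k) : T →* T).ker
    have : Finite torsion := (hT.finite_setOf_pow_eq_one k).to_subtype
    have : torsion.Characteristic := Subgroup.characteristic_iff_comap_eq.2 fun φ => by
      ext x
      simp [torsion, MonoidHom.mem_ker, ← map_pow]
    have : (torsion.map T.subtype).Normal := ConjAct.normal_of_characteristic_of_normal
    have : Finite (torsion.map T.subtype) := (Set.toFinite (torsion : Set T)).image _
    refine ⟨H ⊔ torsion.map T.subtype, lt_of_le_not_ge le_sup_left fun h => htH ?_,
      relIndex_sup_ne_zero H⟩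
    exact h (le_sup_right (a := H) (Subgroup.mem_map.2 ⟨⟨t, htT⟩, hk, rfl⟩))

theorem lt_normalizer (hS : IsDiscretePToral p S) (hH : H ≠ ⊤) :
    H < Subgroup.normalizer (H : Set S) := by
  obtain ⟨K, hHK, hK0⟩ := hS.exists_gt_relIndex_ne_zero hH
  have lt := lt_normalizer_of_index_ne_zero (hS.isPGroup.to_subgroup K) hK0
    fun h => hHK.not_ge (Subgroup.subgroupOf_eq_top.1 h)
  refine lt_of_le_not_ge Subgroup.le_normalizer fun h => lt.not_ge ?_
  rw [← Subgroup.subgroupOf_normalizer_eq hHK.le]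
  exact Subgroup.comap_mono h

end IsDiscretePToral

end NormalizerCondition

section CentralizerBound

open scoped commutatorElement IsMulCommutative

variable {p : ℕ} {S : Type*} [Group S]

theorem mem_centralizer_singleton_comm {x y : S} :
    x ∈ Subgroup.centralizer {y} ↔ y ∈ Subgroup.centralizer {x} := by
  rw [Subgroup.mem_centralizer_singleton_iff, Subgroup.mem_centralizer_singleton_iff, eq_comm]

theorem relIndex_centralizer_ne_zero_and_le {K : Subgroup S} {y : S} {s : Set S} (hs : s.Finite)
    (h : ∀ k ∈ K, ⁅k, y⁆ ∈ s) :
    (Subgroup.centralizer {y}).relIndex K ≠ 0 ∧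
      (Subgroup.centralizer {y}).relIndex K ≤ s.ncard := by
  have := hs.to_subtype
  let f : (K ⧸ (Subgroup.centralizer {y}).subgroupOf K) → s := fun c => ⟨_, h c.out c.out.2⟩
  have hf : Function.Injective f := by
    intro c d hcd
    have conj_eq : c.out.1 * y * (c.out.1)⁻¹ = d.out.1 * y * (d.out.1)⁻¹ :=
      mul_right_cancel (congrArg Subtype.val hcd)
    rw [← c.out_eq', ← d.out_eq']
    refine QuotientGroup.eq.2 (Subgroup.mem_centralizer_singleton_iff.2 ?_)
    calc (c.out.1)⁻¹ * d.out.1 * y = (c.out.1)⁻¹ * (d.out.1 * y * (d.out.1)⁻¹) * d.out.1 := by group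
      _ = y * ((c.out.1)⁻¹ * d.out.1) := by rw [← conj_eq]; group
  have := Finite.of_injective f hf
  exact ⟨Subgroup.index_ne_zero_of_finite, Nat.card_le_card_of_injective f hf⟩

theorem commutatorElement_pow_index_eq_one {T : Subgroup S} [T.Normal] [IsMulCommutative T]
    {t y : S} (ht : t ∈ T)
    (hty : t ∈ Subgroup.normalizer (Subgroup.centralizer {y} : Set S)) :
    ⁅t, y⁆ ∈ T ∧ ⁅t, y⁆ ^ T.index = 1 := by
  have conj_mem : t * y * t⁻¹ ∈ Subgroup.centralizer {y} :=
    (Subgroup.mem_normalizer_iff.1 hty y).1 (Subgroup.mem_centralizer_singleton_iff.2 rfl)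
  have comm : Commute ⁅t, y⁆ y :=
    Commute.mul_left (Subgroup.mem_centralizer_singleton_iff.1 conj_mem) (Commute.refl y).inv_left
  have pow_comm : Commute t (y ^ T.index) :=
    congrArg Subtype.val (mul_comm (⟨t, ht⟩ : T) ⟨_, T.pow_index_mem y⟩)
  refine ⟨Subgroup.commutator_le_left T ⊤ (Subgroup.commutator_mem_commutator ht trivial), ?_⟩
  have pow_eq : (⁅t, y⁆ * y) ^ T.index = y ^ T.index := by
    rw [commutatorElement_def, inv_mul_cancel_right, conj_pow, pow_comm.eq, mul_inv_cancel_right]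
  rwa [comm.mul_pow, mul_eq_right] at pow_eq

theorem inf_centralizer_eq_of_mk_eq {T : Subgroup S} [IsMulCommutative T] {y z : S}
    (h : (y : S ⧸ T) = z) : T ⊓ Subgroup.centralizer {y} = T ⊓ Subgroup.centralizer {z} := by
  ext x
  simp only [Subgroup.mem_inf]
  refine and_congr_right fun hx => ?_
  have comm : y⁻¹ * z ∈ Subgroup.centralizer {x} := Subgroup.mem_centralizer_singleton_iff.2
    (congrArg Subtype.val (mul_comm (⟨_, QuotientGroup.eq.1 h⟩ : T) ⟨x, hx⟩))
  rw [mem_centralizer_singleton_comm, mem_centralizer_singleton_comm (y := z),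
    ← Subgroup.mul_mem_cancel_right _ comm, mul_inv_cancel_left]

theorem relIndex_inf_centralizer_ne_zero_and_le {T N : Subgroup S} [T.Normal]
    [IsMulCommutative T] (index_ne_zero : T.index ≠ 0)
    (hfin : {x : T | x ^ T.index = 1}.Finite) {y : S}
    (hN : N ≤ Subgroup.normalizer (Subgroup.centralizer {y} : Set S)) :
    (T ⊓ Subgroup.centralizer {y}).relIndex N ≠ 0 ∧
      (T ⊓ Subgroup.centralizer {y}).relIndex N ≤
        {x : T | x ^ T.index = 1}.ncard * T.index := by
  obtain ⟨relIndex_ne_zero, hle⟩ := relIndex_centralizer_ne_zero_and_le (K := T ⊓ N) (y := y)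
    (hfin.image Subtype.val) fun t ht => by
      obtain ⟨mem, pow_eq⟩ := commutatorElement_pow_index_eq_one ht.1 (hN ht.2)
      exact ⟨⟨_, mem⟩, Subtype.ext pow_eq, rfl⟩
  have index_dvd := T.relIndex_dvd_index_of_normal N
  rw [Set.ncard_image_of_injective _ Subtype.val_injective] at hle
  rw [inf_comm, ← Subgroup.relIndex_inf_mul_relIndex]
  exact ⟨mul_ne_zero relIndex_ne_zero (ne_zero_of_dvd_ne_zero index_ne_zero index_dvd),
    Nat.mul_le_mul hle (Nat.le_of_dvd (Nat.pos_of_ne_zero index_ne_zero) index_dvd)⟩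

variable [hp : Fact p.Prime]

/-- For the maximal torus `T`, the group `C_T(y)` depends only on the coset `yT`, so that there are
finitely many such groups, and its index in `N` is bounded: for `t ∈ T ⊓ N` the commutator `⁅t, y⁆`
is one of the finitely many elements of `T` whose order divides `|S : T|`. -/
theorem IsDiscretePToral.finite_toralOrder (hS : IsDiscretePToral p S) :
    {x : ℕ × ℕ | ∃ (y : S) (N : Subgroup S), Subgroup.centralizer {y} ≤ N ∧
      N ≤ Subgroup.normalizer (Subgroup.centralizer {y} : Set S) ∧
      HasToralOrder p N x.1 x.2}.Finite := by
  obtain ⟨-, T, hTn, hT, index_ne_zero⟩ := isDiscretePToral_iff.1 hS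
  have : T.FiniteIndex := ⟨index_ne_zero⟩
  have := hT.isMulCommutative
  obtain ⟨a, ha⟩ := hS.isPGroup.index T
  have torsion_finite : {x : T | x ^ T.index = 1}.Finite := ha ▸ hT.finite_setOf_pow_eq_one a
  have finite_range : (Set.range fun y : S => T ⊓ Subgroup.centralizer {y}).Finite :=
    (Set.finite_range fun c : S ⧸ T => T ⊓ Subgroup.centralizer {c.out}).subset <| by
      rintro _ ⟨y, rfl⟩
      exact ⟨y, inf_centralizer_eq_of_mk_eq (QuotientGroup.out_eq' _)⟩
  choose r m hrm using fun A : Subgroup S => hS.to_subgroup A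
  obtain ⟨R, hR⟩ := (finite_range.image r).bddAbove
  obtain ⟨M, hM⟩ := (finite_range.image m).bddAbove
  refine (Set.finite_Iic (R, M * ({x : T | x ^ T.index = 1}.ncard * T.index))).subset ?_
  rintro ⟨s, n⟩ ⟨y, N, le_N, N_le, hN⟩
  obtain ⟨relIndex_ne_zero, hle⟩ :=
    relIndex_inf_centralizer_ne_zero_and_le index_ne_zero torsion_finite N_le
  have A_le : T ⊓ Subgroup.centralizer {y} ≤ N := inf_le_right.trans le_N
  rw [Subgroup.relIndex, ← Subgroup.inclusion_range A_le] at relIndex_ne_zero hle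
  obtain ⟨rfl, rfl⟩ := (hrm (T ⊓ Subgroup.centralizer {y})).eq_mul_index_of_ne_zero hN
    (Subgroup.inclusion_injective A_le) relIndex_ne_zero
  exact ⟨hR ⟨_, ⟨y, rfl⟩, rfl⟩, Nat.mul_le_mul (hM ⟨_, ⟨y, rfl⟩, rfl⟩) hle⟩

theorem IsDiscretePToral.exists_forall_toralOrderLE (hS : IsDiscretePToral p S)
    {fam : Set (Subgroup S)} (hne : fam.Nonempty)
    (h : ∀ N ∈ fam, ∃ y : S, Subgroup.centralizer {y} ≤ N ∧
      N ≤ Subgroup.normalizer (Subgroup.centralizer {y} : Set S)) :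
    ∃ M ∈ fam, ∀ N ∈ fam, ToralOrderLE p N M := by
  choose r m hrm using fun N : Subgroup S => hS.to_subgroup N
  have image_finite : ((fun N => toLex (r N, m N)) '' fam).Finite :=
    (hS.finite_toralOrder.image toLex).subset <| by
      rintro _ ⟨N, hN, rfl⟩
      obtain ⟨y, le_N, N_le⟩ := h N hN
      exact ⟨_, ⟨y, N, le_N, N_le, hrm N⟩, rfl⟩
  obtain ⟨M, hM, hmax⟩ := Set.exists_max_image _ id image_finite (hne.image _)
  obtain ⟨M, hM, rfl⟩ := hM
  exact ⟨M, hM, fun N hN => ⟨_, _, _, _, hrm N, hrm M,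
    Prod.Lex.toLex_le_toLex.1 (hmax _ ⟨N, hN, rfl⟩)⟩⟩

end CentralizerBound

/-! ### Extension of morphisms in fusion systems -/

namespace FusionSystem

variable {p : ℕ} {S : Type u} [Group S] {F : FusionSystem S}

theorem inclusion_mem {P Q : Subgroup S} (h : P ≤ Q) : Subgroup.inclusion h ∈ F.Hom P Q := by
  have conjHom_one : conjHom (1 : S) (Transports.of_le h) = Subgroup.inclusion h := by
    ext x
    simp [conjHom]
  exact conjHom_one ▸ F.conj_mem (1 : S) (Transports.of_le h)

theorem IsIso.symm {P Q : Subgroup S} {e : P ≃* Q} (h : F.IsIso e) : F.IsIso e.symm :=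
  ⟨h.2, h.1⟩

theorem IsIso.trans {P Q R : Subgroup S} {e : P ≃* Q} {f : Q ≃* R} (he : F.IsIso e)
    (hf : F.IsIso f) : F.IsIso (e.trans f) :=
  ⟨F.comp_mem _ he.1 _ hf.1, F.comp_mem _ hf.2 _ he.2⟩

theorem IsConj.refl (P : Subgroup S) : F.IsConj P P :=
  ⟨MulEquiv.refl P, F.id_mem P, F.id_mem P⟩

theorem IsConj.symm {P Q : Subgroup S} (h : F.IsConj P Q) : F.IsConj Q P := by
  obtain ⟨e, he⟩ := h
  exact ⟨e.symm, he.symm⟩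

theorem IsConj.trans {P Q R : Subgroup S} (h : F.IsConj P Q) (h' : F.IsConj Q R) :
    F.IsConj P R := by
  obtain ⟨e, he⟩ := h
  obtain ⟨f, hf⟩ := h'
  exact ⟨e.trans f, he.trans hf⟩

theorem exists_isIso {P Q : Subgroup S} {f : P →* Q} (hf : f ∈ F.Hom P Q) :
    ∃ (R : Subgroup S) (e : P ≃* R), R ≤ Q ∧ F.IsIso e ∧ ∀ x : P, (e x : S) = f x := by
  obtain ⟨R, hR, e, he, he', rfl⟩ := F.factor f hf
  exact ⟨R, e, hR, ⟨he, he'⟩, fun x => rfl⟩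

theorem IsIso.comp_inclusion_mem {P Q R : Subgroup S} {e : P ≃* Q} (he : F.IsIso e) (h : Q ≤ R) :
    (Subgroup.inclusion h).comp e.toMonoidHom ∈ F.Hom P R :=
  F.comp_mem _ he.1 _ (inclusion_mem h)

theorem IsIso.exists_restrict {P Q A : Subgroup S} {e : P ≃* Q} (he : F.IsIso e) (h : A ≤ P) :
    ∃ (B : Subgroup S) (f : A ≃* B), B ≤ Q ∧ F.IsIso f ∧
      ∀ x : A, (f x : S) = e ⟨x, h x.2⟩ :=
  exists_isIso (F.comp_mem _ (inclusion_mem h) _ he.1)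

theorem IsCentric.of_isConj {P Q : Subgroup S} (hP : F.IsCentric P) (h : F.IsConj P Q) :
    F.IsCentric Q := fun R hR => hP R (h.trans hR)

theorem IsCentric.mem_of_mem_centralizer {P : Subgroup S} (hP : F.IsCentric P) {x : S}
    (hx : x ∈ Subgroup.centralizer (P : Set S)) : x ∈ P := by
  rw [hP P (IsConj.refl P)] at hx
  obtain ⟨y, -, rfl⟩ := hx
  exact y.2

theorem IsCentric.of_le {P Q : Subgroup S} (hP : F.IsCentric P) (h : P ≤ Q) :
    F.IsCentric Q := by
  rintro Q' ⟨e, he⟩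
  obtain ⟨P', f, hP'Q', hf, -⟩ := he.exists_restrict h
  apply le_antisymm
  · intro x hx
    have hxP : x ∈ P' := (hP.of_isConj ⟨f, hf⟩).mem_of_mem_centralizer
      (Subgroup.centralizer_le hP'Q' hx)
    refine ⟨⟨x, hP'Q' hxP⟩, ?_, rfl⟩
    rw [SetLike.mem_coe, Subgroup.mem_center_iff]
    exact fun g => Subtype.ext (Subgroup.mem_centralizer_iff.1 hx g g.2)
  · rintro _ ⟨x, hx, rfl⟩
    rw [Subgroup.mem_centralizer_iff]
    exact fun g hg => congrArg Subtype.val (Subgroup.mem_center_iff.1 hx ⟨g, hg⟩)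

theorem mem_autS_iff {P : Subgroup S} {a : MulAut P} :
    a ∈ autS P ↔ ∃ s ∈ Subgroup.normalizer (P : Set S), ∀ x : P, (a x : S) = s * x * s⁻¹ := by
  constructor
  · rintro ⟨s, rfl⟩
    exact ⟨s, s.2, fun x => rfl⟩
  · rintro ⟨s, hs, h⟩
    exact ⟨⟨s, hs⟩, MulEquiv.ext fun x => Subtype.ext (h x).symm⟩

theorem innAut_le_autS (P : Subgroup S) : innAut P ≤ autS P := by
  rintro _ ⟨x, rfl⟩
  exact mem_autS_iff.2 ⟨x, Subgroup.le_normalizer x.2, fun y => by simp⟩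

theorem autS_le_aut (P : Subgroup S) : autS P ≤ F.aut P := by
  rintro _ ⟨s, rfl⟩
  constructor
  · exact F.conj_mem s.1 (Transports.of_mem_normalizer s.2)
  · change MulEquiv.toMonoidHom (P.normalizerMonoidHom s)⁻¹ ∈ F.Hom P P
    rw [← map_inv]
    exact F.conj_mem (s⁻¹).1 (Transports.of_mem_normalizer (s⁻¹).2)

theorem mem_extender_iff {P Q : Subgroup S} {f : P ≃* Q} {s : S} :
    s ∈ extender f ↔ ∃ hs : s ∈ Subgroup.normalizer (P : Set S),
      MulAut.congr f (P.normalizerMonoidHom ⟨s, hs⟩) ∈ autS Q := by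
  constructor
  · rintro ⟨⟨s, hs⟩, h, rfl⟩
    exact ⟨hs, h⟩
  · rintro ⟨hs, h⟩
    exact ⟨⟨s, hs⟩, h, rfl⟩

theorem le_extender {P Q : Subgroup S} (f : P ≃* Q) : P ≤ extender f := by
  intro x hx
  refine mem_extender_iff.2 ⟨Subgroup.le_normalizer hx, innAut_le_autS Q ⟨f ⟨x, hx⟩, ?_⟩⟩
  ext y
  have conj_apply : P.normalizerMonoidHom ⟨x, Subgroup.le_normalizer hx⟩ (f.symm y) =
      ⟨x, hx⟩ * f.symm y * ⟨x, hx⟩⁻¹ := rfl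
  simp [MulAut.congr, conj_apply]

theorem centralizer_le_extender {P Q : Subgroup S} (f : P ≃* Q) :
    Subgroup.centralizer (P : Set S) ≤ extender f := by
  intro s hs
  have hsn : s ∈ Subgroup.normalizer (P : Set S) := Subgroup.centralizer_le_normalizer _ hs
  have conj_eq_one : P.normalizerMonoidHom ⟨s, hsn⟩ = 1 := by
    ext x
    change s * x * s⁻¹ = x
    rw [← Subgroup.mem_centralizer_iff.1 hs x x.2, mul_inv_cancel_right]
  refine mem_extender_iff.2 ⟨hsn, ?_⟩
  rw [conj_eq_one, map_one]
  exact Subgroup.one_mem _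

/-- `z` is fixed by all morphisms of `F` defined on `P`. -/
def Fixes (F : FusionSystem S) (z : S) (P : Subgroup S) : Prop :=
  ∀ f ∈ F.Hom P ⊤, ∀ hz : z ∈ P, (f ⟨z, hz⟩ : S) = z

theorem Fixes.apply_isIso {z : S} {P Q : Subgroup S} (h : F.Fixes z P) {e : P ≃* Q}
    (he : F.IsIso e) (hz : z ∈ P) : (e ⟨z, hz⟩ : S) = z :=
  h _ (he.comp_inclusion_mem le_top) hz

theorem fixes_of_isIso {z : S} {P : Subgroup S}
    (h : ∀ (Q : Subgroup S) (e : P ≃* Q), F.IsIso e → ∀ hz : z ∈ P, (e ⟨z, hz⟩ : S) = z) :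
    F.Fixes z P := by
  intro f hf hz
  obtain ⟨R, e, -, he, hef⟩ := exists_isIso hf
  rw [← hef]
  exact h R e he hz

theorem Fixes.of_isConj {z : S} {P Q : Subgroup S} (h : F.Fixes z P) (hPQ : F.IsConj P Q)
    (hz : z ∈ P) : F.Fixes z Q := by
  obtain ⟨e, he⟩ := hPQ
  intro f hf hzQ
  have e_apply : e ⟨z, hz⟩ = ⟨z, hzQ⟩ := Subtype.ext (h.apply_isIso he hz)
  rw [← e_apply]
  exact h _ (F.comp_mem _ he.1 _ hf) hz

theorem IsSaturated.apply_eq_of_fixes_extender (hF : F.IsSaturated p) {P Q : Subgroup S}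
    {f : P ≃* Q} (hf : F.IsIso f) (hQ : F.FullyCentralised p Q) {z : S} (hz : z ∈ P)
    (h : F.Fixes z (extender f)) : (f ⟨z, hz⟩ : S) = z := by
  obtain ⟨g, hg, hgf⟩ := hF.extension P Q f hf hQ
  rw [← hgf z hz (le_extender f hz)]
  exact h g hg _

theorem fullyCentralised_of_le_center [Fact p.Prime] (hS : IsDiscretePToral p S) {A : Subgroup S}
    (hA : A ≤ Subgroup.center S) : F.FullyCentralised p A := by
  have hAtop : Subgroup.centralizer (A : Set S) = ⊤ := Subgroup.centralizer_eq_top_iff_subset.2 hA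
  exact fun P' _ => hS.toralOrderLE_of_le (hAtop ▸ le_top)

/-- A central element `z` of `S` generates a fully centralised subgroup, so that a morphism
carrying `x` to `z` extends to the centraliser of `x`. -/
theorem IsSaturated.exists_extension_centralizer [Fact p.Prime] (hS : IsDiscretePToral p S)
    (hF : F.IsSaturated p) {z : S} (hz : z ∈ Subgroup.center S) {P Q : Subgroup S} {e : P ≃* Q}
    (he : F.IsIso e) (hzP : z ∈ P) :
    ∃ g ∈ F.Hom (Subgroup.centralizer {(e ⟨z, hzP⟩ : S)}) ⊤,
      ∀ h, (g ⟨e ⟨z, hzP⟩, h⟩ : S) = z := by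
  set x : Q := e ⟨z, hzP⟩ with hx
  obtain ⟨A, f, -, hf, hfx⟩ := he.symm.exists_restrict
    (A := Subgroup.zpowers (x : S)) (by simp)
  have f_zpow : ∀ n : ℤ, (f ⟨(x : S) ^ n, n, rfl⟩ : S) = z ^ n := by
    intro n
    rw [hfx]
    change (e.symm (x ^ n) : S) = z ^ n
    rw [map_zpow, hx, e.symm_apply_apply, Subgroup.coe_zpow]
  have hA : A ≤ Subgroup.center S := by
    intro a ha
    obtain ⟨⟨_, n, rfl⟩, hn⟩ := f.surjective ⟨a, ha⟩
    have hna : z ^ n = a := (f_zpow n).symm.trans (congrArg Subtype.val hn)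
    exact hna ▸ Subgroup.zpow_mem _ hz n
  obtain ⟨g, hg, hgf⟩ := hF.extension _ A f hf (fullyCentralised_of_le_center hS hA)
  have hle : Subgroup.centralizer {(x : S)} ≤ extender f := by
    refine le_trans ?_ (centralizer_le_extender f)
    rw [← Subgroup.centralizer_closure, ← Subgroup.zpowers_eq_closure]
  refine ⟨_, F.comp_mem _ (inclusion_mem hle) _ hg, fun h => ?_⟩
  have f_apply : (f ⟨x, Subgroup.mem_zpowers _⟩ : S) = z := by
    simpa only [zpow_one] using f_zpow 1
  exact (hgf (x : S) (Subgroup.mem_zpowers _) (hle h)).trans f_apply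

theorem mem_autS_of_mk_mem_outS {P : Subgroup S} {a : F.aut P}
    (h : (QuotientGroup.mk a : F.Out P) ∈ F.outS P) : (a : MulAut P) ∈ autS P := by
  obtain ⟨b, hb, hba⟩ := h
  have inner : (b⁻¹ * a : F.aut P) ∈ (innAut P).subgroupOf (F.aut P) := QuotientGroup.eq.1 hba
  simpa using (autS P).mul_mem (Subgroup.mem_subgroupOf.1 hb)
    (innAut_le_autS P (Subgroup.mem_subgroupOf.1 inner))

theorem IsIso.congr_mem {P Q : Subgroup S} {f : P ≃* Q} (hf : F.IsIso f) {a : MulAut P}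
    (ha : a ∈ F.aut P) : MulAut.congr f a ∈ F.aut Q :=
  hf.symm.trans (IsIso.trans ha hf)

/-- Sylow's theorem in `Out_F(Q)` provides `χ`: it conjugates the `p`-group that `N_S(P)` induces
on `Q` through `f` into `Out_S(Q)`. -/
theorem IsSaturated.exists_aut_normalizer_le_extender [Fact p.Prime] (hS : IsPGroup p S)
    (hF : F.IsSaturated p) {P Q : Subgroup S} {f : P ≃* Q} (hf : F.IsIso f)
    (hQ : F.FullyNormalised p Q) :
    ∃ χ : Q ≃* Q, F.IsIso χ ∧ Subgroup.normalizer (P : Set S) ≤ extender (f.trans χ) := by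
  obtain ⟨-, hfin, -, hsyl⟩ := hF.sylow Q hQ
  let Φ : Subgroup.normalizer (P : Set S) →* F.aut Q :=
    ((MulAut.congr f).toMonoidHom.comp P.normalizerMonoidHom).codRestrict (F.aut Q)
      fun s => hf.congr_mem (autS_le_aut P ⟨s, rfl⟩)
  let Ψ : Subgroup.normalizer (P : Set S) →* F.Out Q := (QuotientGroup.mk' _).comp Φ
  have hK : IsPGroup p Ψ.range :=
    (hS.to_subgroup _).of_surjective Ψ.rangeRestrict Ψ.rangeRestrict_surjective
  obtain ⟨g, hg⟩ := hsyl Ψ.range (isDiscretePToral_of_isPGroup hK)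
  obtain ⟨χ, rfl⟩ := QuotientGroup.mk_surjective g
  refine ⟨χ.1, χ.2, fun s hs => mem_extender_iff.2 ⟨hs, ?_⟩⟩
  exact mem_autS_of_mk_mem_outS (a := χ * Φ ⟨s, hs⟩ * χ⁻¹) (hg _ ⟨⟨s, hs⟩, rfl⟩)

theorem IsSaturated.le_outS_of_normal [Fact p.Prime] (hF : F.IsSaturated p) {Q : Subgroup S}
    (hQ : F.FullyNormalised p Q) {K : Subgroup (F.Out Q)} (hKn : K.Normal) (hKp : IsPGroup p K) :
    K ≤ F.outS Q := by
  obtain ⟨-, hfin, -, hsyl⟩ := hF.sylow Q hQ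
  obtain ⟨g, hg⟩ := hsyl K (isDiscretePToral_of_isPGroup hKp)
  intro k hk
  simpa [mul_assoc] using hg _ (hKn.conj_mem k hk g⁻¹)

/-- The elements of `N_S(Q)` that induce a nontrivial normal `p`-subgroup of `Out_F(Q)` belong to
the extender of every automorphism of `Q`. -/
theorem IsSaturated.lt_extender_of_not_isRadical [Fact p.Prime] (hF : F.IsSaturated p)
    {Q : Subgroup S} (hQ : F.FullyNormalised p Q) (hr : ¬ F.IsRadical p Q) {χ : Q ≃* Q}
    (hχ : F.IsIso χ) : Q < extender χ := by
  rw [IsRadical] at hr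
  push Not at hr
  obtain ⟨K, hKn, hKp, hK⟩ := hr
  have hKS : K ≤ F.outS Q := hF.le_outS_of_normal hQ hKn hKp
  obtain ⟨k, hk, hk1⟩ := K.bot_or_exists_ne_one.resolve_left hK
  obtain ⟨a, ha, rfl⟩ := hKS hk
  obtain ⟨s, hs⟩ := Subgroup.mem_subgroupOf.1 ha
  have hsχ : (s : S) ∈ extender χ := by
    refine mem_extender_iff.2 ⟨s.2, ?_⟩
    let χ' : F.aut Q := ⟨χ, hχ⟩
    have conj_mem : (QuotientGroup.mk (χ' * a * χ'⁻¹) : F.Out Q) ∈ K :=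
      hKn.conj_mem _ hk (QuotientGroup.mk χ')
    have conj_eq : MulAut.congr χ (Q.normalizerMonoidHom s) =
        ((χ' * a * χ'⁻¹ : F.aut Q) : MulAut Q) := by
      rw [hs]
      rfl
    exact conj_eq ▸ mem_autS_of_mk_mem_outS (hKS conj_mem)
  refine lt_of_le_of_ne (le_extender χ) fun h => hk1 ?_
  rw [QuotientGroup.mk'_apply, QuotientGroup.eq_one_iff, Subgroup.mem_subgroupOf]
  refine ⟨⟨s, h.ge hsχ⟩, ?_⟩
  rw [← hs]
  exact MulEquiv.ext fun y => rfl

end FusionSystem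

/-! ### Alperin's argument for a single element -/

namespace FusionSystem

variable {p : ℕ} {S : Type u} [Group S] {F : FusionSystem S}

theorem IsCentric.mem_of_mem_center {P : Subgroup S} (hP : F.IsCentric P) {z : S}
    (hz : z ∈ Subgroup.center S) : z ∈ P :=
  hP.mem_of_mem_centralizer (Subgroup.center_le_centralizer _ hz)

theorem fixes_top [Fact p.Prime] (hS : IsDiscretePToral p S) {z : S}
    (h : ∀ e ∈ F.aut ⊤, (e ⟨z, Subgroup.mem_top z⟩ : S) = z) : F.Fixes z ⊤ := by
  refine fixes_of_isIso fun Q e he hz => ?_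
  obtain rfl : Q = ⊤ := eq_of_le_of_toralOrderLE (p := p) le_top
    ((hS.toralOrderLE_of_le (le_refl (⊤ : Subgroup S))).congr (MulEquiv.refl _) e)
  exact h e he

theorem exists_fullyNormalised_of_centralizer [Fact p.Prime] (hS : IsDiscretePToral p S)
    {P : Subgroup S} (h : ∀ Q, F.IsConj P Q → ∃ y : S, Q = Subgroup.centralizer {y}) :
    ∃ Q, F.IsConj P Q ∧ F.FullyNormalised p Q := by
  obtain ⟨_, ⟨Q, hQ, rfl⟩, hmax⟩ := hS.exists_forall_toralOrderLE
    (fam := (fun Q : Subgroup S => Subgroup.normalizer (Q : Set S)) '' {Q | F.IsConj P Q})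
    ⟨_, P, IsConj.refl P, rfl⟩ (by
      rintro _ ⟨Q, hQ, rfl⟩
      obtain ⟨y, rfl⟩ := h Q hQ
      exact ⟨y, Subgroup.le_normalizer, le_rfl⟩)
  exact ⟨Q, hQ, fun P' hP' => hmax _ ⟨P', hQ.trans hP', rfl⟩⟩

theorem IsSaturated.apply_eq_of_fullyNormalised [Fact p.Prime] (hS : IsDiscretePToral p S)
    (hF : F.IsSaturated p) {z : S} {P Q : Subgroup S} (hP : F.FullyNormalised p P) (hzP : z ∈ P)
    (hQ : Q ≠ ⊤) (hover : ∀ R, Q < R → F.Fixes z R)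
    (haut : ∀ e ∈ F.aut P, (e ⟨z, hzP⟩ : S) = z)
    {f : Q ≃* P} (hf : F.IsIso f) (hzQ : z ∈ Q) : (f ⟨z, hzQ⟩ : S) = z := by
  obtain ⟨χ, hχ, hle⟩ := hF.exists_aut_normalizer_le_extender hS.isPGroup hf hP
  have comp_apply : f.trans χ ⟨z, hzQ⟩ = ⟨z, hzP⟩ :=
    Subtype.ext (hF.apply_eq_of_fixes_extender (hf.trans hχ) (hF.sylow P hP).1 hzQ
      (hover _ ((hS.lt_normalizer hQ).trans_le hle)))
  have χ_symm_apply := haut χ.symm hχ.symm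
  rw [← comp_apply] at χ_symm_apply
  simpa using χ_symm_apply

theorem IsSaturated.fixes_of_fullyNormalised [Fact p.Prime] (hS : IsDiscretePToral p S)
    (hF : F.IsSaturated p) {z : S} {P : Subgroup S} (hP : F.FullyNormalised p P)
    (hz : ∀ Q, F.IsConj P Q → z ∈ Q) (htop : ¬ F.IsConj P ⊤)
    (hover : ∀ Q R, F.IsConj P Q → Q < R → F.Fixes z R)
    (haut : ∀ e ∈ F.aut P, ∀ hzP : z ∈ P, (e ⟨z, hzP⟩ : S) = z) :
    F.Fixes z P := by
  refine fixes_of_isIso fun Q e he hzP => ?_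
  have hPQ : F.IsConj P Q := ⟨e, he⟩
  have symm_apply : e.symm ⟨z, hz Q hPQ⟩ = ⟨z, hzP⟩ :=
    Subtype.ext (hF.apply_eq_of_fullyNormalised hS hP hzP (fun h => htop (h ▸ hPQ))
      (fun R => hover Q R hPQ) (fun a ha => haut a ha hzP) he.symm (hz Q hPQ))
  rw [← symm_apply, e.apply_symm_apply]

variable {z x : S}

/-- The elements other than `z` that are images of `z` under isomorphisms of `F` between centric
subgroups; they measure the failure of `F` to fix `z`. -/
def movedImages (F : FusionSystem S) (z : S) : Set S :=
  {x | x ≠ z ∧ ∃ (Q R : Subgroup S) (e : Q ≃* R) (hzQ : z ∈ Q),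
    F.IsCentric Q ∧ F.IsIso e ∧ (e ⟨z, hzQ⟩ : S) = x}

theorem movedImages_nonempty {P : Subgroup S} (hP : F.IsCentric P) (h : ¬ F.Fixes z P) :
    (F.movedImages z).Nonempty := by
  contrapose! h
  refine fixes_of_isIso fun Q e he hzP => ?_
  by_contra hne
  exact h.subset ⟨hne, P, Q, e, hzP, hP, he, rfl⟩

theorem le_centralizer_apply (hz : z ∈ Subgroup.center S) {Q R : Subgroup S} (e : Q ≃* R)
    (hzQ : z ∈ Q) : R ≤ Subgroup.centralizer {(e ⟨z, hzQ⟩ : S)} := by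
  intro y hy
  have comm : (⟨y, hy⟩ : R) * e ⟨z, hzQ⟩ = e ⟨z, hzQ⟩ * ⟨y, hy⟩ := by
    apply e.symm.injective
    rw [map_mul, map_mul, e.symm_apply_apply]
    exact Subtype.ext (Subgroup.mem_center_iff.1 hz _)
  exact Subgroup.mem_centralizer_singleton_iff.2 (congrArg Subtype.val comm)

theorem isCentric_centralizer (hz : z ∈ Subgroup.center S) (hx : x ∈ F.movedImages z) :
    F.IsCentric (Subgroup.centralizer {x}) := by
  obtain ⟨-, Q, R, e, hzQ, hQ, he, rfl⟩ := hx
  exact (hQ.of_isConj ⟨e, he⟩).of_le (le_centralizer_apply hz e hzQ)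

theorem IsSaturated.exists_isIso_centralizer [Fact p.Prime] (hS : IsDiscretePToral p S)
    (hF : F.IsSaturated p) (hz : z ∈ Subgroup.center S) (hx : x ∈ F.movedImages z) :
    ∃ (R : Subgroup S) (g : Subgroup.centralizer {x} ≃* R), F.IsIso g ∧
      ∀ h, (g ⟨x, h⟩ : S) = z := by
  obtain ⟨-, Q, R, e, hzQ, -, he, rfl⟩ := hx
  obtain ⟨g, hg, hgx⟩ := hF.exists_extension_centralizer hS hz he hzQ
  obtain ⟨R', g', -, hg', hgg'⟩ := exists_isIso hg
  exact ⟨R', g', hg', fun h => (hgg' _).trans (hgx h)⟩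

/-- `x` is a moved image of `z` whose centraliser has the greatest order among the centralisers
of moved images. -/
structure IsLargestMovedImage (p : ℕ) (F : FusionSystem S) (z x : S) : Prop where
  mem : x ∈ F.movedImages z
  toralOrderLE : ∀ y ∈ F.movedImages z,
    ToralOrderLE p (Subgroup.centralizer {y}) (Subgroup.centralizer {x})

theorem exists_isLargestMovedImage [Fact p.Prime] (hS : IsDiscretePToral p S)
    (h : (F.movedImages z).Nonempty) : ∃ x, F.IsLargestMovedImage p z x := by
  obtain ⟨_, ⟨x, hx, rfl⟩, hmax⟩ := hS.exists_forall_toralOrderLE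
    (fam := (fun x : S => Subgroup.centralizer {x}) '' F.movedImages z) (h.image _) (by
      rintro _ ⟨y, -, rfl⟩
      exact ⟨y, le_rfl, Subgroup.le_normalizer⟩)
  exact ⟨x, hx, fun y hy => hmax _ ⟨y, hy, rfl⟩⟩

namespace IsLargestMovedImage

theorem mem_of_isConj (hx : F.IsLargestMovedImage p z x) (hz : z ∈ Subgroup.center S)
    {Q : Subgroup S} (hQ : F.IsConj (Subgroup.centralizer {x}) Q) : z ∈ Q :=
  ((isCentric_centralizer hz hx.mem).of_isConj hQ).mem_of_mem_center hz

variable [Fact p.Prime]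

theorem not_fixes (hx : F.IsLargestMovedImage p z x) (hS : IsDiscretePToral p S)
    (hF : F.IsSaturated p) (hz : z ∈ Subgroup.center S) {Q : Subgroup S}
    (hQ : F.IsConj (Subgroup.centralizer {x}) Q) : ¬ F.Fixes z Q := by
  intro hfix
  obtain ⟨R, g, hg, hgx⟩ := hF.exists_isIso_centralizer hS hz hx.mem
  have hfixC := hfix.of_isConj hQ.symm (hx.mem_of_isConj hz hQ)
  have hxC := Subgroup.mem_centralizer_singleton_iff.2 (rfl : x * x = x * x)
  have g_apply : g ⟨z, hx.mem_of_isConj hz (IsConj.refl _)⟩ = g ⟨x, hxC⟩ :=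
    Subtype.ext ((hfixC.apply_isIso hg _).trans (hgx hxC).symm)
  exact hx.mem.1 (congrArg Subtype.val (g.injective g_apply)).symm

theorem eq_of_le (hx : F.IsLargestMovedImage p z x) (hS : IsDiscretePToral p S)
    {Q R R' : Subgroup S} (hQ : F.IsConj (Subgroup.centralizer {x}) Q) (hQR : Q ≤ R)
    (e : R ≃* R') {y : S} (hy : y ∈ F.movedImages z) (hR' : R' ≤ Subgroup.centralizer {y}) :
    Q = R := by
  obtain ⟨f, -⟩ := hQ
  have hR'Q : ToralOrderLE p R' Q :=
    ((hS.toralOrderLE_of_le hR').trans (hx.toralOrderLE y hy)).congr (MulEquiv.refl _) f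
  exact eq_of_le_of_toralOrderLE hQR (hR'Q.congr e.symm (MulEquiv.refl _))

theorem fixes_of_lt (hx : F.IsLargestMovedImage p z x) (hS : IsDiscretePToral p S)
    (hz : z ∈ Subgroup.center S) {Q R : Subgroup S}
    (hQ : F.IsConj (Subgroup.centralizer {x}) Q) (hQR : Q < R) : F.Fixes z R := by
  refine fixes_of_isIso fun R' e he hzR => ?_
  by_contra hne
  have hR : F.IsCentric R := ((isCentric_centralizer hz hx.mem).of_isConj hQ).of_le hQR.le
  exact hQR.ne (hx.eq_of_le hS hQ hQR.le e ⟨hne, R, R', e, hzR, hR, he, rfl⟩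
    (le_centralizer_apply hz e hzR))

theorem exists_isIso_apply_ne (hx : F.IsLargestMovedImage p z x) (hS : IsDiscretePToral p S)
    (hF : F.IsSaturated p) (hz : z ∈ Subgroup.center S) {Q : Subgroup S}
    (hQ : F.IsConj (Subgroup.centralizer {x}) Q) :
    ∃ (R : Subgroup S) (e : R ≃* Q) (hzR : z ∈ R), F.IsCentric R ∧ F.IsIso e ∧
      (e ⟨z, hzR⟩ : S) ≠ z := by
  by_contra! h
  refine hx.not_fixes hS hF hz hQ (fixes_of_isIso fun R e he hzQ => ?_)
  have hR : F.IsConj (Subgroup.centralizer {x}) R := hQ.trans ⟨e, he⟩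
  have symm_apply : e.symm ⟨z, hx.mem_of_isConj hz hR⟩ = ⟨z, hzQ⟩ := Subtype.ext
    (h R e.symm _ ((isCentric_centralizer hz hx.mem).of_isConj hR) he.symm)
  rw [← symm_apply, e.apply_symm_apply]

theorem exists_eq_centralizer (hx : F.IsLargestMovedImage p z x) (hS : IsDiscretePToral p S)
    (hF : F.IsSaturated p) (hz : z ∈ Subgroup.center S) {Q : Subgroup S}
    (hQ : F.IsConj (Subgroup.centralizer {x}) Q) : ∃ y : S, Q = Subgroup.centralizer {y} := by
  obtain ⟨R, e, hzR, hR, he, hne⟩ := hx.exists_isIso_apply_ne hS hF hz hQ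
  exact ⟨e ⟨z, hzR⟩, hx.eq_of_le hS hQ (le_centralizer_apply hz e hzR) (MulEquiv.refl _)
    ⟨hne, R, Q, e, hzR, hR, he, rfl⟩ le_rfl⟩

theorem not_forall_aut_apply_eq (hx : F.IsLargestMovedImage p z x) (hS : IsDiscretePToral p S)
    (hF : F.IsSaturated p) (hz : z ∈ Subgroup.center S) {Q : Subgroup S}
    (hQ : F.IsConj (Subgroup.centralizer {x}) Q) (hQn : F.FullyNormalised p Q)
    (htop : F.Fixes z ⊤) : ¬ ∀ e ∈ F.aut Q, ∀ hzQ : z ∈ Q, (e ⟨z, hzQ⟩ : S) = z :=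
  fun haut => hx.not_fixes hS hF hz hQ (hF.fixes_of_fullyNormalised hS hQn
    (fun _ hR => hx.mem_of_isConj hz (hQ.trans hR))
    (fun h => hx.not_fixes hS hF hz (hQ.trans h) htop)
    (fun _ _ hR => hx.fixes_of_lt hS hz (hQ.trans hR)) haut)

end IsLargestMovedImage

/-- Alperin's argument: otherwise choose a moved image `x` of `z` with centraliser of greatest
order. A fully normalised conjugate of that centraliser is conjugate to a member of the family if
it is radical, and otherwise its automorphisms extend to overgroups, which fix `z`. -/
theorem IsSaturated.fixes_of_isFusionControlling [Fact p.Prime] (hS : IsDiscretePToral p S)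
    (hF : F.IsSaturated p) {fam : Set (Subgroup S)} (hfam : F.IsFusionControlling p fam)
    (hz : z ∈ Subgroup.center S)
    (hfix : ∀ P ∈ fam, ∀ e ∈ F.aut P, ∀ hzP : z ∈ P, (e ⟨z, hzP⟩ : S) = z)
    {P : Subgroup S} (hP : F.IsCentric P) : F.Fixes z P := by
  by_contra hmoved
  obtain ⟨x, hx⟩ := exists_isLargestMovedImage hS (movedImages_nonempty hP hmoved)
  have htop : F.Fixes z ⊤ := fixes_top hS fun e he => hfix ⊤ hfam.top_mem e he _
  obtain ⟨Q, hCQ, hQ⟩ := exists_fullyNormalised_of_centralizer hS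
    fun _ => hx.exists_eq_centralizer hS hF hz
  by_cases hr : F.IsRadical p Q
  · obtain ⟨Q', hQ'fam, hQQ'⟩ :=
      hfam.exists_conj Q ((isCentric_centralizer hz hx.mem).of_isConj hCQ) hr
    exact hx.not_forall_aut_apply_eq hS hF hz (hCQ.trans hQQ') (hfam.fullyNormalised Q' hQ'fam)
      htop (hfix Q' hQ'fam)
  · refine hx.not_forall_aut_apply_eq hS hF hz hCQ hQ htop fun e he hzQ => ?_
    exact hF.apply_eq_of_fixes_extender he (hF.sylow Q hQ).1 hzQ
      (hx.fixes_of_lt hS hz hCQ (hF.lt_extender_of_not_isRadical hQ hr he))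

end FusionSystem

/-! ### Central elements of amalgamated products -/

section ReducedWords

open Monoid Monoid.PushoutI

variable {ι : Type*} {G : ι → Type*} {H : Type*} [∀ i, Group (G i)] [Group H]
  {φ : ∀ i, H →* G i}

variable (φ) in
/-- The product in the amalgam of a list of letters. -/
def letterProd (l : List (Σ i, G i)) : PushoutI φ := (l.map fun x => of x.1 x.2).prod

variable (φ) in
/-- Reduced words as lists: consecutive letters belong to different factors and no letter belongs
to the base group. Unlike in `Monoid.PushoutI.NormalWord`, no transversals are involved, so that
inverses and concatenations are easy to form. -/
def IsReducedList (l : List (Σ i, G i)) : Prop :=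
  l.IsChain (fun x y => x.1 ≠ y.1) ∧ ∀ x ∈ l, x.2 ∉ (φ x.1).range

/-- The formal inverse of a list of letters. -/
def invLetters (l : List (Σ i, G i)) : List (Σ i, G i) :=
  (l.map fun x => ⟨x.1, x.2⁻¹⟩).reverse

theorem letterProd_cons (x : Σ i, G i) (l : List (Σ i, G i)) :
    letterProd φ (x :: l) = of x.1 x.2 * letterProd φ l := by
  simp [letterProd]

theorem letterProd_append (l l' : List (Σ i, G i)) :
    letterProd φ (l ++ l') = letterProd φ l * letterProd φ l' := by
  simp [letterProd]

theorem letterProd_invLetters (l : List (Σ i, G i)) :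
    letterProd φ (invLetters l) = (letterProd φ l)⁻¹ := by
  simp only [letterProd, invLetters, List.map_reverse, List.map_map, List.prod_inv_reverse]
  congr 3

theorem isReducedList_cons {x : Σ i, G i} {l : List (Σ i, G i)} :
    IsReducedList φ (x :: l) ↔
      x.2 ∉ (φ x.1).range ∧ (∀ y ∈ l.head?, x.1 ≠ y.1) ∧ IsReducedList φ l := by
  simp only [IsReducedList, List.isChain_cons, List.forall_mem_cons]
  tauto

theorem isReducedList_append {l l' : List (Σ i, G i)} :
    IsReducedList φ (l ++ l') ↔ IsReducedList φ l ∧ IsReducedList φ l' ∧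
      ∀ x ∈ l.getLast?, ∀ y ∈ l'.head?, x.1 ≠ y.1 := by
  simp only [IsReducedList, List.isChain_append, List.forall_mem_append]
  tauto

theorem isReducedList_invLetters {l : List (Σ i, G i)} (hl : IsReducedList φ l) :
    IsReducedList φ (invLetters l) := by
  constructor
  · rw [invLetters, List.isChain_reverse, List.isChain_map]
    exact hl.1.imp fun _ _ h => h.symm
  · intro x hx
    simp only [invLetters, List.mem_reverse, List.mem_map] at hx
    obtain ⟨y, hy, rfl⟩ := hx
    simpa using hl.2 y hy

theorem IsReducedList.letterProd_ne_one (hφ : ∀ i, Function.Injective (φ i))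
    {l : List (Σ i, G i)} (hl : IsReducedList φ l) (hne : l ≠ []) : letterProd φ l ≠ 1 := by
  intro h
  let w : CoprodI.Word G := ⟨l, fun x hx hx1 => hl.2 x hx (hx1 ▸ Subgroup.one_mem _), hl.1⟩
  have hw : Reduced φ w := hl.2
  have prod_eq : ofCoprodI (φ := φ) w.prod = letterProd φ l := by
    simp only [CoprodI.Word.prod, letterProd, map_list_prod, List.map_map, w]
    rfl
  have w_empty := hw.eq_empty_of_mem_range hφ (by rw [prod_eq, h]; exact Subgroup.one_mem _)
  exact hne (congrArg CoprodI.Word.toList w_empty)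

theorem exists_eq_base_mul_letterProd (hφ : ∀ i, Function.Injective (φ i)) (g : PushoutI φ) :
    ∃ (b : H) (l : List (Σ i, G i)), IsReducedList φ l ∧ g = base φ b * letterProd φ l := by
  classical
  obtain ⟨d⟩ := NormalWord.transversal_nonempty φ hφ
  let w : NormalWord d := NormalWord.equiv g
  refine ⟨w.head, w.toList, ⟨w.chain_ne, ?_⟩, ?_⟩
  · rintro ⟨i, x⟩ hx hr
    have factorisation_unique := (d.compl i).1 (a₁ := (⟨x, hr⟩, ⟨1, d.one_mem i⟩))
      (a₂ := (⟨1, Subgroup.one_mem _⟩, ⟨x, w.normalized i x hx⟩)) (by simp)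
    exact w.ne_one _ hx (congrArg (fun t => (t.1 : G i)) factorisation_unique)
  · have hw : w.prod = g := (NormalWord.equiv (d := d)).symm_apply_apply g
    rw [← hw, NormalWord.prod]
    congr 1
    simp only [CoprodI.Word.prod, letterProd, map_list_prod, List.map_map]
    rfl

theorem eq_base_or_eq_letterProd (hφ : ∀ i, Function.Injective (φ i)) (g : PushoutI φ) :
    (∃ b, g = base φ b) ∨ ∃ x l, IsReducedList φ (x :: l) ∧ g = letterProd φ (x :: l) := by
  obtain ⟨b, l, hl, rfl⟩ := exists_eq_base_mul_letterProd hφ g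
  rcases l with _ | ⟨x, l⟩
  · exact Or.inl ⟨b, by simp [letterProd]⟩
  obtain ⟨hx, hxl, hl⟩ := isReducedList_cons.1 hl
  refine Or.inr ⟨⟨x.1, φ x.1 b * x.2⟩, l, isReducedList_cons.2 ⟨fun h => hx ?_, hxl, hl⟩, ?_⟩
  · exact (Subgroup.mul_mem_cancel_left _ (MonoidHom.mem_range.2 ⟨b, rfl⟩)).1 h
  · rw [letterProd_cons, letterProd_cons, map_mul, of_apply_eq_base, mul_assoc]

/-- The commutator of `w` and the word is again a nonempty reduced word. -/
theorem IsReducedList.not_commute (hφ : ∀ i, Function.Injective (φ i)) {l : List (Σ i, G i)}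
    (hl : IsReducedList φ l) (hne : l ≠ []) {w : Σ i, G i} (hw : w.2 ∉ (φ w.1).range)
    (hhead : ∀ x ∈ l.head?, w.1 ≠ x.1) (hlast : ∀ x ∈ l.getLast?, x.1 ≠ w.1) :
    ¬ Commute (of w.1 w.2) (letterProd φ l) := by
  intro hcomm
  have hinv : IsReducedList φ (⟨w.1, w.2⁻¹⟩ :: invLetters l) := by
    refine isReducedList_cons.2 ⟨by simpa using hw, fun y hy => ?_, isReducedList_invLetters hl⟩
    simp only [invLetters, List.head?_reverse, List.getLast?_map, Option.mem_def,
      Option.map_eq_some_iff] at hy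
    obtain ⟨t, ht, rfl⟩ := hy
    exact (hlast t ht).symm
  have hred : IsReducedList φ (w :: (l ++ ⟨w.1, w.2⁻¹⟩ :: invLetters l)) := by
    refine isReducedList_cons.2 ⟨hw, ?_, isReducedList_append.2 ⟨hl, hinv, ?_⟩⟩
    · rwa [List.head?_append_of_ne_nil _ hne]
    · simpa using hlast
  refine hred.letterProd_ne_one hφ (by simp) ?_
  rw [letterProd_cons, letterProd_append, letterProd_cons, letterProd_invLetters, ← mul_assoc,
    hcomm.eq, map_inv]
  group

theorem IsReducedList.letterProd_notMem_center (hφ : ∀ i, Function.Injective (φ i))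
    {x y : Σ i, G i} {l : List (Σ i, G i)} (hl : IsReducedList φ (x :: y :: l)) :
    letterProd φ (x :: y :: l) ∉ Subgroup.center (PushoutI φ) := by
  intro hg
  obtain ⟨hx, hxy, htail⟩ := isReducedList_cons.1 hl
  have x_ne_y : x.1 ≠ y.1 := hxy y rfl
  by_cases hlast : ∀ t ∈ (y :: l).getLast?, t.1 ≠ x.1
  · refine htail.not_commute hφ (by simp) hx hxy hlast ?_
    have hcomm := Subgroup.mem_center_iff.1 hg (of x.1 x.2)
    rw [letterProd_cons, mul_assoc] at hcomm
    exact mul_left_cancel hcomm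
  · push Not at hlast
    obtain ⟨t, ht, htx⟩ := hlast
    refine hl.not_commute hφ (by simp) (isReducedList_cons.1 htail).1 ?_ ?_
      (Subgroup.mem_center_iff.1 hg _)
    · simpa using x_ne_y.symm
    · intro s hs
      rw [List.getLast?_cons_cons] at hs
      rwa [Option.mem_unique hs ht, htx]

theorem eq_base_or_eq_of_of_mem_center (hφ : ∀ i, Function.Injective (φ i)) {g : PushoutI φ}
    (hg : g ∈ Subgroup.center (PushoutI φ)) : (∃ b, g = base φ b) ∨ ∃ i x, g = of i x := by
  rcases eq_base_or_eq_letterProd hφ g with hb | ⟨x, l, hl, rfl⟩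
  · exact Or.inl hb
  rcases l with _ | ⟨y, l⟩
  · exact Or.inr ⟨x.1, x.2, by simp [letterProd]⟩
  · exact absurd hg (hl.letterProd_notMem_center hφ)

end ReducedWords

section BinaryAmalgam

variable {A B N : Type u} [Group A] [Group B] [Group N] (k : N →* A) (j : N →* B)

/-- Two groups as a family, so that their amalgam is an instance of `Monoid.PushoutI`. -/
abbrev PairFamily (A B : Type u) : Bool → Type u
  | true => A
  | false => B

instance PairFamily.group : ∀ b, Group (PairFamily A B b)
  | true => inferInstanceAs (Group A)
  | false => inferInstanceAs (Group B)

/-- The two edge maps `k : N → A` and `j : N → B` as a family. -/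
def pairMap : ∀ b, N →* PairFamily A B b
  | true => k
  | false => j

/-- The amalgamated product `A *_N B`. -/
abbrev BinaryAmalgam : Type u := Monoid.PushoutI (pairMap k j)

namespace BinaryAmalgam

/-- The canonical homomorphism `A → A *_N B`. -/
def inl : A →* BinaryAmalgam k j := Monoid.PushoutI.of (φ := pairMap k j) true

/-- The canonical homomorphism `B → A *_N B`. -/
def inr : B →* BinaryAmalgam k j := Monoid.PushoutI.of (φ := pairMap k j) false

variable {k j}

theorem inl_apply_eq_base (n : N) : inl k j (k n) = Monoid.PushoutI.base (pairMap k j) n :=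
  Monoid.PushoutI.of_apply_eq_base (pairMap k j) true n

theorem inl_apply_eq_inr_apply (n : N) : inl k j (k n) = inr k j (j n) :=
  (inl_apply_eq_base n).trans (Monoid.PushoutI.of_apply_eq_base (pairMap k j) false n).symm

theorem hom_ext {K : Type*} [Group K] {f g : BinaryAmalgam k j →* K}
    (hl : f.comp (inl k j) = g.comp (inl k j)) (hr : f.comp (inr k j) = g.comp (inr k j)) :
    f = g := by
  refine Monoid.PushoutI.hom_ext_nonempty fun b => ?_
  cases b
  · exact hr
  · exact hl

/-- The homomorphism out of `A *_N B` given by homomorphisms on `A` and `B` that agree on `N`. -/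
def lift {K : Type*} [Group K] (f : A →* K) (g : B →* K) (h : f.comp k = g.comp j) :
    BinaryAmalgam k j →* K :=
  Monoid.PushoutI.lift (Bool.rec g f) (f.comp k) (by
    rintro (_ | _)
    · exact h.symm
    · rfl)

@[simp]
theorem lift_inl {K : Type*} [Group K] (f : A →* K) (g : B →* K) (h : f.comp k = g.comp j)
    (a : A) : lift f g h (inl k j a) = f a :=
  Monoid.PushoutI.lift_of (φ := pairMap k j) (i := true) _ _ _ a

@[simp]
theorem lift_inr {K : Type*} [Group K] (f : A →* K) (g : B →* K) (h : f.comp k = g.comp j)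
    (b : B) : lift f g h (inr k j b) = g b :=
  Monoid.PushoutI.lift_of (φ := pairMap k j) (i := false) _ _ _ b

theorem pairMap_injective (hk : Function.Injective k) (hj : Function.Injective j) :
    ∀ b, Function.Injective (pairMap k j b)
  | true => hk
  | false => hj

theorem inl_injective (hk : Function.Injective k) (hj : Function.Injective j) :
    Function.Injective (inl k j) :=
  Monoid.PushoutI.of_injective (pairMap_injective hk hj) true

theorem inr_injective (hk : Function.Injective k) (hj : Function.Injective j) :
    Function.Injective (inr k j) :=
  Monoid.PushoutI.of_injective (pairMap_injective hk hj) false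

theorem eq_inl_or_eq_inr_of_mem_center (hk : Function.Injective k) (hj : Function.Injective j)
    {g : BinaryAmalgam k j} (hg : g ∈ Subgroup.center (BinaryAmalgam k j)) :
    (∃ a, g = inl k j a) ∨ ∃ b, g = inr k j b := by
  rcases eq_base_or_eq_of_of_mem_center (pairMap_injective hk hj) hg with ⟨n, rfl⟩ | ⟨b, x, rfl⟩
  · exact Or.inl ⟨k n, (inl_apply_eq_base n).symm⟩
  · cases b
    · exact Or.inr ⟨x, rfl⟩
    · exact Or.inl ⟨x, rfl⟩

end BinaryAmalgam

end BinaryAmalgam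

section StarAmalgam

variable {E A : Type u} {B N : E → Type u} [Group A] [∀ e, Group (B e)] [∀ e, Group (N e)]
  (k : ∀ e, N e →* A) (j : ∀ e, N e →* B e)

/-- The amalgam of a star of groups with central vertex group `A`, and for each `e : E` a leaf with
vertex group `B e` and an edge with group `N e`. It is formed as the amalgam over `A` of the groups
`A *_{N e} B e`. -/
abbrev StarAmalgam : Type u := Monoid.PushoutI fun e => BinaryAmalgam.inl (k e) (j e)

namespace StarAmalgam

/-- The canonical homomorphism from the central vertex group. -/
def ofCentre : A →* StarAmalgam k j := Monoid.PushoutI.base _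

/-- The canonical homomorphism from the amalgam of a single edge. -/
def ofEdge (e : E) : BinaryAmalgam (k e) (j e) →* StarAmalgam k j :=
  Monoid.PushoutI.of (φ := fun e => BinaryAmalgam.inl (k e) (j e)) e

/-- The canonical homomorphism from the vertex group of a leaf. -/
def ofLeaf (e : E) : B e →* StarAmalgam k j := (ofEdge k j e).comp (BinaryAmalgam.inr (k e) (j e))

variable {k j}

theorem ofEdge_inl (e : E) (a : A) :
    ofEdge k j e (BinaryAmalgam.inl (k e) (j e) a) = ofCentre k j a :=
  Monoid.PushoutI.of_apply_eq_base (fun e => BinaryAmalgam.inl (k e) (j e)) e a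

theorem ofCentre_apply_eq_ofLeaf_apply (e : E) (n : N e) :
    ofCentre k j (k e n) = ofLeaf k j e (j e n) := by
  rw [← ofEdge_inl e, BinaryAmalgam.inl_apply_eq_inr_apply]
  rfl

theorem hom_ext {K : Type*} [Group K] {f g : StarAmalgam k j →* K}
    (hc : f.comp (ofCentre k j) = g.comp (ofCentre k j))
    (hl : ∀ e, f.comp (ofLeaf k j e) = g.comp (ofLeaf k j e)) : f = g := by
  refine Monoid.PushoutI.hom_ext (fun e => BinaryAmalgam.hom_ext ?_ (hl e)) hc
  ext a
  change f (ofEdge k j e (BinaryAmalgam.inl (k e) (j e) a)) =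
    g (ofEdge k j e (BinaryAmalgam.inl (k e) (j e) a))
  rw [ofEdge_inl]
  exact DFunLike.congr_fun hc a

/-- The homomorphism out of the amalgam of a star of groups given by homomorphisms on the vertex
groups that agree on the edge groups. -/
def lift {K : Type*} [Group K] (f : A →* K) (g : ∀ e, B e →* K)
    (h : ∀ e, f.comp (k e) = (g e).comp (j e)) : StarAmalgam k j →* K :=
  Monoid.PushoutI.lift (fun e => BinaryAmalgam.lift f (g e) (h e)) f fun e =>
    MonoidHom.ext fun a => BinaryAmalgam.lift_inl f (g e) (h e) a

@[simp]
theorem lift_ofCentre {K : Type*} [Group K] (f : A →* K) (g : ∀ e, B e →* K)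
    (h : ∀ e, f.comp (k e) = (g e).comp (j e)) (a : A) : lift f g h (ofCentre k j a) = f a :=
  Monoid.PushoutI.lift_base _ _ _ a

@[simp]
theorem lift_ofLeaf {K : Type*} [Group K] (f : A →* K) (g : ∀ e, B e →* K)
    (h : ∀ e, f.comp (k e) = (g e).comp (j e)) (e : E) (b : B e) :
    lift f g h (ofLeaf k j e b) = g e b :=
  (Monoid.PushoutI.lift_of _ _ _ _).trans (BinaryAmalgam.lift_inr f (g e) (h e) b)

theorem ofCentre_injective (hk : ∀ e, Function.Injective (k e))
    (hj : ∀ e, Function.Injective (j e)) : Function.Injective (ofCentre k j) :=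
  Monoid.PushoutI.base_injective fun e => BinaryAmalgam.inl_injective (hk e) (hj e)

theorem ofEdge_injective (hk : ∀ e, Function.Injective (k e))
    (hj : ∀ e, Function.Injective (j e)) (e : E) : Function.Injective (ofEdge k j e) :=
  Monoid.PushoutI.of_injective (fun e => BinaryAmalgam.inl_injective (hk e) (hj e)) e

theorem ofLeaf_injective (hk : ∀ e, Function.Injective (k e))
    (hj : ∀ e, Function.Injective (j e)) (e : E) : Function.Injective (ofLeaf k j e) :=
  (ofEdge_injective hk hj e).comp (BinaryAmalgam.inr_injective (hk e) (hj e))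

theorem eq_ofCentre_or_eq_ofLeaf_of_mem_center (hk : ∀ e, Function.Injective (k e))
    (hj : ∀ e, Function.Injective (j e)) {g : StarAmalgam k j}
    (hg : g ∈ Subgroup.center (StarAmalgam k j)) :
    (∃ a, g = ofCentre k j a) ∨ ∃ e b, g = ofLeaf k j e b := by
  rcases eq_base_or_eq_of_of_mem_center
    (fun e => BinaryAmalgam.inl_injective (hk e) (hj e)) hg with ha | ⟨e, x, hx⟩
  · exact Or.inl ha
  replace hx : g = ofEdge k j e x := hx
  have hxc : x ∈ Subgroup.center (BinaryAmalgam (k e) (j e)) := by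
    refine Subgroup.mem_center_iff.2 fun y => ofEdge_injective hk hj e ?_
    rw [map_mul, map_mul, ← hx, Subgroup.mem_center_iff.1 hg]
  rcases BinaryAmalgam.eq_inl_or_eq_inr_of_mem_center (hk e) (hj e) hxc with ⟨a, rfl⟩ | ⟨b, rfl⟩
  · exact Or.inl ⟨a, hx.trans (ofEdge_inl e a)⟩
  · exact Or.inr ⟨e, b, hx⟩

end StarAmalgam

end StarAmalgam

namespace RobinsonSetup

variable {p : ℕ} {S : Type u} [Group S] {𝒢 : PLocalCompactGroup p S} (R : RobinsonSetup 𝒢)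

theorem hom_ext {K : Type u} [Group K] {f g : R.amalgam →* K}
    (h : ∀ v, f.comp (R.ofVertex v) = g.comp (R.ofVertex v)) : f = g := by
  suffices hfg : (GrpCat.ofHom f : R.amalgam ⟶ GrpCat.of K) = GrpCat.ofHom g from
    congrArg GrpCat.Hom.hom hfg
  exact Multicofork.IsColimit.hom_ext (colimit.isColimit R.treeOfGroups)
    fun v => GrpCat.hom_ext (h v)

theorem mem_center_of_commute {g : R.amalgam}
    (h : ∀ v x, R.ofVertex v x * g = g * R.ofVertex v x) : g ∈ Subgroup.center R.amalgam := by
  have hconj : (MulAut.conj g).toMonoidHom = MonoidHom.id R.amalgam :=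
    R.hom_ext fun v => MonoidHom.ext fun x => mul_inv_eq_iff_eq_mul.2 (h v x).symm
  exact Subgroup.mem_center_iff.2 fun x =>
    (mul_inv_eq_iff_eq_mul.1 (DFunLike.congr_fun hconj x)).symm

/-- The vertex `v_P` at the end of the edge `e_P`. -/
def edgeVertex (e : R.Edge) : R.Vertex := ⟨e.1, e.2.1⟩

theorem eq_vTop {v : R.Vertex} (h : v.1.sub = ⊤) : v = R.vTop := by
  obtain ⟨⟨P, hP⟩, hv⟩ := v
  obtain rfl : P = ⊤ := h
  rfl

theorem eq_vTop_or_eq_edgeVertex (v : R.Vertex) : v = R.vTop ∨ ∃ e, v = R.edgeVertex e := by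
  by_cases h : v.1.sub = ⊤
  · exact Or.inl (R.eq_vTop h)
  · exact Or.inr ⟨⟨v.1, v.2, h⟩, rfl⟩

/-- The edge map `k_P : N_P → L_S` at the end `v_S` of the edge `e_P`. -/
abbrev edgeToTop (e : R.Edge) : R.N e.1 e.2.1 e.2.2 →* Aut 𝒢.topL := R.k e.1 e.2.1 e.2.2

/-- The edge map `j_P : N_P → L_P` at the end `v_P` of the edge `e_P`. -/
abbrev edgeToLeaf (e : R.Edge) : R.N e.1 e.2.1 e.2.2 →* Aut e.1 := (R.N e.1 e.2.1 e.2.2).subtype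

theorem edgeToTop_injective (e : R.Edge) : Function.Injective (R.edgeToTop e) :=
  R.k_injective e.1 e.2.1 e.2.2

theorem edgeToLeaf_injective (e : R.Edge) : Function.Injective (R.edgeToLeaf e) :=
  Subgroup.subtype_injective _

theorem ofVertex_vTop_edgeToTop (e : R.Edge) (n : R.N e.1 e.2.1 e.2.2) :
    R.ofVertex R.vTop (R.edgeToTop e n) = R.ofVertex (R.edgeVertex e) (R.edgeToLeaf e n) := by
  have hfst := colimit.w R.treeOfGroups (WalkingMultispan.Hom.fst e)
  have hsnd := colimit.w R.treeOfGroups (WalkingMultispan.Hom.snd e)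
  exact congrArg (fun f => f.hom n) (hfst.trans hsnd.symm)

/-- The Robinson tree is a star with centre `v_S`; this is the amalgam of the corresponding star of
groups, built from amalgamated products so that reduced words are available. -/
abbrev Star : Type u := StarAmalgam R.edgeToTop R.edgeToLeaf

/-- The canonical homomorphism from `L_S` to the amalgam of the star. -/
abbrev topToStar : Aut 𝒢.topL →* R.Star := StarAmalgam.ofCentre R.edgeToTop R.edgeToLeaf

/-- The canonical homomorphism from `L_P`, for `P ≠ S`, to the amalgam of the star. -/
abbrev leafToStar (e : R.Edge) : Aut e.1 →* R.Star :=
  StarAmalgam.ofLeaf R.edgeToTop R.edgeToLeaf e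

open Classical in
/-- The canonical homomorphism from a vertex group to the amalgam of the star. -/
noncomputable def vertexToStar (v : R.Vertex) : Aut v.1 →* R.Star :=
  if h : v.1.sub = ⊤ then R.eq_vTop h ▸ R.topToStar else R.leafToStar ⟨v.1, v.2, h⟩

theorem vertexToStar_vTop : R.vertexToStar R.vTop = R.topToStar := dif_pos rfl

theorem vertexToStar_edgeVertex (e : R.Edge) :
    R.vertexToStar (R.edgeVertex e) = R.leafToStar e :=
  dif_neg e.2.2

theorem vertexToStar_injective (v : R.Vertex) : Function.Injective (R.vertexToStar v) := by
  rcases R.eq_vTop_or_eq_edgeVertex v with rfl | ⟨e, rfl⟩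
  · rw [vertexToStar_vTop]
    exact StarAmalgam.ofCentre_injective R.edgeToTop_injective R.edgeToLeaf_injective
  · rw [vertexToStar_edgeVertex]
    exact StarAmalgam.ofLeaf_injective R.edgeToTop_injective R.edgeToLeaf_injective e

theorem vertexToStar_vTop_edgeToTop (e : R.Edge) (n : R.N e.1 e.2.1 e.2.2) :
    R.vertexToStar R.vTop (R.edgeToTop e n) =
      R.vertexToStar (R.edgeVertex e) (R.edgeToLeaf e n) := by
  rw [vertexToStar_vTop, vertexToStar_edgeVertex]
  exact StarAmalgam.ofCentre_apply_eq_ofLeaf_apply (j := R.edgeToLeaf) e n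

/-- The comparison homomorphism from the Robinson amalgam to the amalgam of the star. -/
noncomputable def toStar : R.amalgam →* R.Star :=
  (colimit.desc R.treeOfGroups (Multicofork.ofπ R.groups (GrpCat.of R.Star)
    (fun v => GrpCat.ofHom (R.vertexToStar v))
    fun e => GrpCat.hom_ext (MonoidHom.ext (R.vertexToStar_vTop_edgeToTop e)))).hom

theorem toStar_ofVertex (v : R.Vertex) (x : Aut v.1) :
    R.toStar (R.ofVertex v x) = R.vertexToStar v x :=
  DFunLike.congr_fun (congrArg GrpCat.Hom.hom
    (colimit.ι_desc (F := R.treeOfGroups) _ (WalkingMultispan.right v))) x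

/-- The comparison homomorphism from the amalgam of the star to the Robinson amalgam. -/
noncomputable def ofStar : R.Star →* R.amalgam :=
  StarAmalgam.lift (R.ofVertex R.vTop) (fun e => R.ofVertex (R.edgeVertex e))
    fun e => MonoidHom.ext (R.ofVertex_vTop_edgeToTop e)

theorem ofStar_vertexToStar (v : R.Vertex) (x : Aut v.1) :
    R.ofStar (R.vertexToStar v x) = R.ofVertex v x := by
  rcases R.eq_vTop_or_eq_edgeVertex v with rfl | ⟨e, rfl⟩
  · rw [vertexToStar_vTop]
    exact StarAmalgam.lift_ofCentre _ _ _ x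
  · rw [vertexToStar_edgeVertex]
    exact StarAmalgam.lift_ofLeaf (j := R.edgeToLeaf) _ _ _ e x

theorem star_hom_ext {K : Type*} [Group K] {f g : R.Star →* K}
    (h : ∀ v, f.comp (R.vertexToStar v) = g.comp (R.vertexToStar v)) : f = g := by
  have htop : f.comp R.topToStar = g.comp R.topToStar :=
    R.vertexToStar_vTop ▸ h R.vTop
  have hleaf (e : R.Edge) : f.comp (R.leafToStar e) = g.comp (R.leafToStar e) :=
    R.vertexToStar_edgeVertex e ▸ h (R.edgeVertex e)
  exact StarAmalgam.hom_ext htop hleaf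

/-- The Robinson amalgam is the amalgam of the star. -/
noncomputable def amalgamEquivStar : R.amalgam ≃* R.Star :=
  MonoidHom.toMulEquiv R.toStar R.ofStar
    (R.hom_ext fun v => MonoidHom.ext fun x =>
      (congrArg R.ofStar (R.toStar_ofVertex v x)).trans (R.ofStar_vertexToStar v x))
    (R.star_hom_ext fun v => MonoidHom.ext fun x =>
      (congrArg R.toStar (R.ofStar_vertexToStar v x)).trans (R.toStar_ofVertex v x))

theorem amalgamEquivStar_ofVertex (v : R.Vertex) (x : Aut v.1) :
    R.amalgamEquivStar (R.ofVertex v x) = R.vertexToStar v x :=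
  R.toStar_ofVertex v x

theorem ofVertex_injective (v : R.Vertex) : Function.Injective (R.ofVertex v) := by
  intro x y h
  apply R.vertexToStar_injective v
  rw [← amalgamEquivStar_ofVertex, ← amalgamEquivStar_ofVertex, h]

theorem exists_eq_ofVertex_of_mem_center {g : R.amalgam} (hg : g ∈ Subgroup.center R.amalgam) :
    ∃ v x, g = R.ofVertex v x := by
  have hstar : R.amalgamEquivStar g ∈ Subgroup.center R.Star :=
    Subgroup.mem_center_iff.2 <| R.amalgamEquivStar.surjective.forall.2 fun h => by
      rw [← map_mul, ← map_mul, Subgroup.mem_center_iff.1 hg]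
  suffices h : ∃ v x, R.amalgamEquivStar g = R.vertexToStar v x by
    obtain ⟨v, x, hx⟩ := h
    exact ⟨v, x, R.amalgamEquivStar.injective (hx.trans (R.amalgamEquivStar_ofVertex v x).symm)⟩
  rcases StarAmalgam.eq_ofCentre_or_eq_ofLeaf_of_mem_center
    R.edgeToTop_injective R.edgeToLeaf_injective hstar with ⟨x, hx⟩ | ⟨e, x, hx⟩
  · exact ⟨R.vTop, x, hx.trans (DFunLike.congr_fun R.vertexToStar_vTop x).symm⟩
  · exact ⟨R.edgeVertex e, x, hx.trans (DFunLike.congr_fun (R.vertexToStar_edgeVertex e) x).symm⟩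

end RobinsonSetup

/-! ### The centre of the Robinson amalgam -/

theorem exists_limit_π_eq {J : Type u} [Category.{u} J] (F : J ⥤ CommGrpCat.{u})
    (x : ∀ j, F.obj j) (hx : ∀ {i j} (f : i ⟶ j), (F.map f).hom (x i) = x j) :
    ∃ c : (limit F : CommGrpCat.{u}), ∀ j, (limit.π F j).hom c = x j := by
  let e := Types.isLimitEquivSections (isLimitOfPreserves (forget CommGrpCat.{u}) (limit.isLimit F))
  let s : (F ⋙ forget CommGrpCat.{u}).sections := ⟨x, hx⟩
  exact ⟨e.symm s, fun j => congrArg (fun t => t.1 j) (e.apply_symm_apply s)⟩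

namespace TransporterData

variable {p : ℕ} {S : Type u} [Group S] {F : FusionSystem S} {T : TransporterData F}

theorem εAut_injective (hT : T.IsTransporterSystem p) (P : SubgroupIn T.obj) :
    Function.Injective (T.εAut P) := fun _ _ h =>
  Subtype.ext (hT.ε_injective _ _ _ _ (congrArg Iso.hom h))

/-- The restriction of `ε_{P,P}` to a homomorphism `P → Aut_T(P)`. -/
def εSelf (T : TransporterData F) (P : SubgroupIn T.obj) : P.sub →* Aut P :=
  (T.εAut P).comp (Subgroup.inclusion Subgroup.le_normalizer)

theorem εSelf_injective (hT : T.IsTransporterSystem p) (P : SubgroupIn T.obj) :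
    Function.Injective (T.εSelf P) :=
  (εAut_injective hT P).comp (Subgroup.inclusion_injective _)

theorem mul_εSelf (hT : T.IsTransporterSystem p) {P : SubgroupIn T.obj} (a : Aut P) (y : P.sub) :
    a * T.εSelf P y = T.εSelf P (T.ρ a.hom y) * a :=
  Iso.ext (hT.comm a.hom y)

theorem commute_εSelf_iff (hT : T.IsTransporterSystem p) {P : SubgroupIn T.obj} {a : Aut P}
    {y : P.sub} : Commute a (T.εSelf P y) ↔ T.ρ a.hom y = y := by
  rw [commute_iff_eq, mul_εSelf hT, mul_left_inj, (εSelf_injective hT P).eq_iff]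

theorem exists_aut_of_ρ_eq_id (hT : T.IsTransporterSystem p) {P : SubgroupIn T.obj} {φ : P ⟶ P}
    (hφ : T.ρ φ = MonoidHom.id P.sub) : ∃ a : Aut P, a.hom = φ := by
  obtain ⟨a, -, ha⟩ := (hT.ρ_orbit (𝟙 P) φ).1 ((T.ρ_id P).trans hφ.symm)
  exact ⟨a, by rw [← ha, Category.comp_id]⟩

theorem isIso_of_ρ_comp_eq_id (hT : T.IsTransporterSystem p) {P : SubgroupIn T.obj}
    {φ ψ : P ⟶ P} (hφψ : (T.ρ ψ).comp (T.ρ φ) = MonoidHom.id P.sub)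
    (hψφ : (T.ρ φ).comp (T.ρ ψ) = MonoidHom.id P.sub) : IsIso φ := by
  obtain ⟨a, ha⟩ := exists_aut_of_ρ_eq_id hT ((T.ρ_comp φ ψ).trans hφψ)
  obtain ⟨b, hb⟩ := exists_aut_of_ρ_eq_id hT ((T.ρ_comp ψ φ).trans hψφ)
  have : IsSplitMono φ := ⟨⟨⟨ψ ≫ a.inv, by rw [← Category.assoc, ← ha, a.hom_inv_id]⟩⟩⟩
  have : IsSplitEpi φ := ⟨⟨⟨b.inv ≫ ψ, by rw [Category.assoc, ← hb, b.inv_hom_id]⟩⟩⟩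
  exact isIso_of_epi_of_isSplitMono φ

theorem exists_aut_ρ_eq (hT : T.IsTransporterSystem p) {P : SubgroupIn T.obj}
    {e : P.sub ≃* P.sub} (he : F.IsIso e) : ∃ a : Aut P, T.ρ a.hom = e.toMonoidHom := by
  obtain ⟨φ, hφ⟩ := hT.ρ_surjective (P := P) (Q := P) _ he.1
  obtain ⟨ψ, hψ⟩ := hT.ρ_surjective (P := P) (Q := P) _ he.2
  have : IsIso φ := isIso_of_ρ_comp_eq_id (ψ := ψ) hT
    (by rw [hφ, hψ]; exact MonoidHom.ext e.symm_apply_apply)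
    (by rw [hφ, hψ]; exact MonoidHom.ext e.apply_symm_apply)
  exact ⟨asIso φ, hφ⟩

end TransporterData

namespace PLocalCompactGroup

variable {p : ℕ} {S : Type u} [Group S] (𝒢 : PLocalCompactGroup p S)

/-- The projection of the inverse limit `Z(𝒢)` to its component `Z(P)`. -/
noncomputable def centreProj (P : 𝒢.F.OrbitCat) : 𝒢.centre →* Subgroup.center P.sub :=
  (limit.π 𝒢.F.centerFunctor (Opposite.op P)).hom

theorem apply_centreProj (c : 𝒢.centre) {P Q : 𝒢.F.OrbitCat} (f : 𝒢.F.Hom P.sub Q.sub) :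
    f.1 (𝒢.centreProj P c) = 𝒢.centreProj Q c := by
  let φ : P ⟶ Q := Quotient.mk _ f
  have hφ : FusionSystem.centerMap P.centric f (𝒢.centreProj Q c) = 𝒢.centreProj P c :=
    congrArg (fun f => f.hom c) (limit.w 𝒢.F.centerFunctor φ.op)
  rw [← hφ, FusionSystem.apply_centerMap]

theorem coe_centreProj (c : 𝒢.centre) (P : 𝒢.F.OrbitCat) :
    ((𝒢.centreProj P c : P.sub) : S) = (𝒢.centreProj 𝒢.topO c : 𝒢.topO.sub) :=
  congrArg Subtype.val (𝒢.apply_centreProj c (Q := 𝒢.topO)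
    ⟨Subgroup.inclusion le_top, FusionSystem.inclusion_mem le_top⟩)

theorem centreProj_topO_injective : Function.Injective (𝒢.centreProj 𝒢.topO) := by
  intro c d h
  refine Concrete.limit_ext 𝒢.F.centerFunctor c d fun P => Subtype.ext (Subtype.ext ?_)
  exact (𝒢.coe_centreProj c P.unop).trans
    ((congrArg (fun t : Subgroup.center 𝒢.topO.sub => (t.1 : S)) h).trans
      (𝒢.coe_centreProj d P.unop).symm)

theorem exists_centreProj_eq {z : S} (hz : z ∈ Subgroup.center S)
    (hfix : ∀ P, 𝒢.F.IsCentric P → 𝒢.F.Fixes z P) :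
    ∃ c, ((𝒢.centreProj 𝒢.topO c : 𝒢.topO.sub) : S) = z := by
  let zP (P : 𝒢.F.OrbitCat) : Subgroup.center P.sub :=
    ⟨⟨z, P.centric.mem_of_mem_center hz⟩,
      Subgroup.mem_center_iff.2 fun g => Subtype.ext (Subgroup.mem_center_iff.1 hz g)⟩
  have compatible {Q P : 𝒢.F.OrbitCatᵒᵖ} (φ : Q ⟶ P) :
      (𝒢.F.centerFunctor.map φ).hom (zP Q.unop) = zP P.unop := by
    obtain ⟨φ⟩ := φ
    induction φ using Quotient.inductionOn with | _ f
    refine FusionSystem.centerMap_eq_of_apply P.unop.centric f _ _ (Subtype.ext ?_)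
    exact hfix P.unop.sub P.unop.centric _
      (𝒢.F.comp_mem _ f.2 _ (FusionSystem.inclusion_mem le_top))
      (P.unop.centric.mem_of_mem_center hz)
  obtain ⟨c, hc⟩ := exists_limit_π_eq 𝒢.F.centerFunctor (fun P => zP P.unop) compatible
  exact ⟨c, congrArg (fun t : Subgroup.center 𝒢.topO.sub => (t.1 : S)) (hc (Opposite.op 𝒢.topO))⟩

end PLocalCompactGroup

namespace RobinsonSetup

variable {p : ℕ} {S : Type u} [Group S] {𝒢 : PLocalCompactGroup p S} (R : RobinsonSetup 𝒢)

theorem isCentric_of_vertex (v : R.Vertex) : 𝒢.F.IsCentric v.1.sub :=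
  𝒢.linking.obj_eq.le v.1.mem

theorem ofVertex_εAut (v : R.Vertex) (g : Subgroup.normalizer (v.1.sub : Set S)) :
    R.ofVertex v (𝒢.L.εAut v.1 g) = R.ofVertex R.vTop (𝒢.εTop ⟨g, Subgroup.mem_top _⟩) := by
  rcases R.eq_vTop_or_eq_edgeVertex v with rfl | ⟨e, rfl⟩
  · rfl
  · have hamalgam := R.ofVertex_vTop_edgeToTop e ⟨_, R.normalizer_mem e.1 e.2.1 e.2.2 g⟩
    rw [edgeToTop, R.k_normalizer e.1 e.2.1 e.2.2 g] at hamalgam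
    exact hamalgam.symm

theorem ofVertex_εSelf (v : R.Vertex) (y : v.1.sub) :
    R.ofVertex v (𝒢.L.εSelf v.1 y) = R.ofVertex R.vTop (𝒢.εTop ⟨y, Subgroup.mem_top _⟩) :=
  R.ofVertex_εAut v _

theorem ofVertex_εTop_injective :
    Function.Injective fun s => R.ofVertex R.vTop (𝒢.εTop s) :=
  (R.ofVertex_injective R.vTop).comp
    (TransporterData.εSelf_injective 𝒢.linking.toIsTransporterSystem 𝒢.topL)

theorem centreToAmalgam_apply (c : 𝒢.centre) :
    R.centreToAmalgam c = R.ofVertex R.vTop (𝒢.εTop (𝒢.centreProj 𝒢.topO c : 𝒢.topO.sub)) :=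
  rfl

theorem centreToAmalgam_injective : Function.Injective R.centreToAmalgam := fun _ _ h =>
  𝒢.centreProj_topO_injective (Subtype.ext (R.ofVertex_εTop_injective h))

theorem centreToAmalgam_mem_center (c : 𝒢.centre) :
    R.centreToAmalgam c ∈ Subgroup.center R.amalgam := by
  refine R.mem_center_of_commute fun v x => ?_
  let P : 𝒢.F.OrbitCat := ⟨v.1.sub, R.isCentric_of_vertex v⟩
  let y : v.1.sub := (𝒢.centreProj P c : P.sub)
  have hy : 𝒢.L.ρ x.hom y = y := 𝒢.apply_centreProj c (P := P) (Q := P) ⟨_, 𝒢.L.ρ_mem x.hom⟩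
  have hc : R.centreToAmalgam c = R.ofVertex v (𝒢.L.εSelf v.1 y) := by
    rw [ofVertex_εSelf, centreToAmalgam_apply]
    exact congrArg (fun s => R.ofVertex R.vTop (𝒢.εTop s)) (Subtype.ext (𝒢.coe_centreProj c P).symm)
  rw [hc]
  exact ((TransporterData.commute_εSelf_iff 𝒢.linking.toIsTransporterSystem).2 hy).map _

theorem ρ_apply_eq_of_commute {v : R.Vertex} {a : Aut v.1} {y : v.1.sub}
    (h : Commute (R.ofVertex v a) (R.ofVertex v (𝒢.L.εSelf v.1 y))) : 𝒢.L.ρ a.hom y = y :=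
  (TransporterData.commute_εSelf_iff 𝒢.linking.toIsTransporterSystem).1
    (h.of_map (R.ofVertex_injective v))

theorem exists_eq_εTop_of_mem_center {g : R.amalgam} (hg : g ∈ Subgroup.center R.amalgam) :
    ∃ s : (⊤ : Subgroup S), g = R.ofVertex R.vTop (𝒢.εTop s) := by
  obtain ⟨v, x, rfl⟩ := R.exists_eq_ofVertex_of_mem_center hg
  have hx : x ∈ 𝒢.L.E v.1 := MonoidHom.mem_ker.2 <| MulEquiv.ext fun y =>
    R.ρ_apply_eq_of_commute (Subgroup.mem_center_iff.1 hg _).symm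
  rw [𝒢.linking.E_eq] at hx
  obtain ⟨_, ⟨w, -, rfl⟩, rfl⟩ := hx
  exact ⟨⟨w, Subgroup.mem_top _⟩, R.ofVertex_εSelf v w⟩

variable {R} in
theorem mem_center_of_ofVertex_εTop_mem_center {z : (⊤ : Subgroup S)}
    (hz : R.ofVertex R.vTop (𝒢.εTop z) ∈ Subgroup.center R.amalgam) :
    (z : S) ∈ Subgroup.center S := by
  refine Subgroup.mem_center_iff.2 fun s => ?_
  have hcomm : Commute (⟨s, Subgroup.mem_top s⟩ : (⊤ : Subgroup S)) z :=
    Commute.of_map (f := (R.ofVertex R.vTop).comp 𝒢.εTop) R.ofVertex_εTop_injective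
      (Subgroup.mem_center_iff.1 hz _)
  exact congrArg Subtype.val hcomm

variable {R} in
theorem apply_eq_of_ofVertex_εTop_mem_center {z : (⊤ : Subgroup S)}
    (hz : R.ofVertex R.vTop (𝒢.εTop z) ∈ Subgroup.center R.amalgam) {P : Subgroup S}
    (hP : P ∈ R.fam) {e : P ≃* P} (he : e ∈ 𝒢.F.aut P) (hzP : (z : S) ∈ P) :
    (e ⟨z, hzP⟩ : S) = z := by
  let v : R.Vertex := ⟨⟨P, R.fam_subset hP⟩, hP⟩
  obtain ⟨a, ha⟩ := TransporterData.exists_aut_ρ_eq 𝒢.linking.toIsTransporterSystem (P := v.1) he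
  have hfix : 𝒢.L.ρ a.hom ⟨z, hzP⟩ = ⟨z, hzP⟩ := R.ρ_apply_eq_of_commute (v := v) (by
    rw [ofVertex_εSelf]
    exact Subgroup.mem_center_iff.1 hz _)
  rw [ha] at hfix
  exact congrArg Subtype.val hfix

theorem center_le_range_centreToAmalgam [Fact p.Prime] :
    Subgroup.center R.amalgam ≤ R.centreToAmalgam.range := by
  intro g hg
  obtain ⟨z, rfl⟩ := R.exists_eq_εTop_of_mem_center hg
  have hz := mem_center_of_ofVertex_εTop_mem_center hg
  obtain ⟨c, hc⟩ := 𝒢.exists_centreProj_eq hz fun _ =>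
    𝒢.saturated.fixes_of_isFusionControlling 𝒢.toral R.controlling hz
      fun _ hP _ he hzP => apply_eq_of_ofVertex_εTop_mem_center hg hP he hzP
  exact ⟨c, congrArg (fun s => R.ofVertex R.vTop (𝒢.εTop s)) (Subtype.ext hc)⟩

end RobinsonSetup

theorem mainTheorem3 {p : ℕ} [Fact p.Prime] {S : Type u} [Group S] (𝒢 : PLocalCompactGroup p S)
    (R : RobinsonSetup 𝒢) :
    Function.Injective R.centreToAmalgam ∧
      R.centreToAmalgam.range = Subgroup.center R.amalgam := by
  refine ⟨R.centreToAmalgam_injective, le_antisymm ?_ R.center_le_range_centreToAmalgam⟩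
  rintro _ ⟨c, rfl⟩
  exact R.centreToAmalgam_mem_center c
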